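/- **Setting.** Let $\mathscr H$ be a separable complex Hilbert space, $\mathscr M\subset\mathscr B(\mathscr H)$ a von Neumann algebra and $\rho$ a faithful normal semifinite trace on $\mathscr M$. Assume that either $\mathscr M$ is atomic (generated by its minimal projections), or $\mathscr M$ is diffuse (it has no minimal projections) and $\rho(I)=\infty$. For a von Neumann algebra $\mathscr A$ with such a trace, $\mathrm{Proj}(\mathscr A)$ is the set of orthogonal projections in $\mathscr A$, $\mathscr P(\mathscr A)=\{P\in \mathrm{Proj}(\mathscr A):\rho(P)<\infty\}$, and $\mathscr R_1^+(\mathscr A)$ is the set of $a\in\mathscr A$ with $0\le a\le I$ and $aP=a$ for some $P\in\mathscr P(\mathscr A)$. Put $|x|_1=\rho(|x|)$, $L^1(\mathscr A)\cap\mathscr A=\{x\in\mathscr A: |x|_1<\infty\}$, and $\mu(t,x)=\inf\{\|x(I-P)\| : P\in\mathscr P(\mathscr A),\ \rho(P)\le t\}$ for $t>0$. Let $|\cdot|_{\mathscr J}$ be a symmetric operator norm, that is, a norm on $L^1(\mathscr M)\cap\mathscr M$ such that 1. if $\mu(t,x)\le\mu(t,y)$ for all $t>0$, then $|x|_{\mathscr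 J}\le|y|_{\mathscr J}$; 2. there are $C_1,C_2\in(0,\infty)$ with $C_1\inf_{x=y+z}(|y|_1+\|z\|)\le|x|_{\mathscr J}\le C_2(|x|_1+\|x\|)$ for all $x$, the infimum being over $y,z\in L^1(\mathscr M)\cap\mathscr M$; 3. if $P_k\in\mathscr P(\mathscr M)$ and $\rho(P_k)\to0$, then $|P_k|_{\mathscr J}\to0$; 4. for every $m\ge1$, identifying $x$ with $x\otimes e_{11}$, $|\cdot|_{\mathscr J}$ extends to a norm on $L^1\cap(\mathscr M\otimes M_m(\mathbb C))$, formed with the trace $\rho\otimes \mathrm{Tr}_m$, that satisfies the analogues of 1–3. **Condenser modulus.** Let $\alpha=(\alpha_j)_{1\le j\le n}$ be $*$-automorphisms of $\mathscr A$ that preserve $\rho$. For $P,Q\in\mathscr P(\mathscr A)$ with $PQ=0$ put $$k_{\mathscr J,\mathscr A}(\alpha;P,Q)=\inf\Big\{\max_{1\le j\le n}|\alpha_j(A)-A|_{\mathscr J} : A\in\mathscr R_1^+(\mathscr A),\ AP=P,\ AQ=0\Big\},$$ and for general $P,Q\in \mathrm{Proj}(\mathscr A)$ with $PQ=0$ put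 $$k_{\mathscr J,\mathscr A}(\alpha;P,Q)=\sup\{k_{\mathscr J,\mathscr A}(\alpha;P',Q') : P',Q'\in\mathscr P(\mathscr A),\ P'\le P,\ Q'\le Q\}\in[0,\infty].$$ **Proposition 3.2.** Let $\mathscr N\subset\mathscr M$ be a von Neumann subalgebra (with the same unit) such that $\rho|_{\mathscr N}$ is semifinite. Let $E:\mathscr M\to\mathscr N$ be the conditional expectation with respect to $\rho$, that is, the positive linear $\mathscr N$-bimodule projection of $\mathscr M$ onto $\mathscr N$ with $\rho\circ E=\rho$ on positive elements, and assume that $|E(x)|_{\mathscr J}\le|x|_{\mathscr J}$ for all $x\in L^1(\mathscr M)\cap\mathscr M$. Let $\alpha=(\alpha_j)_{1\le j\le n}$ be $*$-automorphisms of $\mathscr M$ with $\rho\circ\alpha_j=\rho$ and $\alpha_j(\mathscr N)=\mathscr N$ for all $j$, and let $P,Q\in \mathrm{Proj}(\mathscr N)$ with $PQ=0$. Then $$k_{\mathscr J,\mathscr M}(\alpha;P,Q)=k_{\mathscr J,\mathscr N}(\alpha|_{\mathscr N};P,Q),$$ where $\mathscr N$ carries the restrictions of $\rho$ and of $|\cdot|_{\mathscr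 J}$. -/

import Mathlib

open scoped NNReal ENNReal Topology
open Filter

namespace Condenser

universe u

section Basics

variable {H : Type u} [NormedAddCommGroup H] [InnerProductSpace ℂ H] [CompleteSpace H]

/-! Throughout, `S` is the underlying set of a von Neumann algebra of operators on `H`, and a trace
on it is given by a function `ρ` of which only the values on the positive elements of `S` matter. -/

/-- `ρ` is semifinite on `S`: each nonzero positive element of `S` dominates a nonzero positive
element of `S` of finite trace. -/
def IsSemifinite (S : Set (H →L[ℂ] H)) (ρ : (H →L[ℂ] H) → ℝ≥0∞) : Prop :=
  ∀ x ∈ S, 0 ≤ x → x ≠ 0 → ∃ y ∈ S, 0 ≤ y ∧ y ≤ x ∧ y ≠ 0 ∧ ρ y < ⊤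

/-- `ρ` is a faithful normal semifinite trace on (the positive cone of) `S`. -/
structure IsFaithfulNormalSemifiniteTrace (S : Set (H →L[ℂ] H)) (ρ : (H →L[ℂ] H) → ℝ≥0∞) :
    Prop where
  map_add : ∀ x ∈ S, ∀ y ∈ S, 0 ≤ x → 0 ≤ y → ρ (x + y) = ρ x + ρ y
  map_smul : ∀ (c : ℝ≥0), ∀ x ∈ S, 0 ≤ x → ρ (((c : ℝ) : ℂ) • x) = (c : ℝ≥0∞) * ρ x
  tracial : ∀ x ∈ S, ρ (star x * x) = ρ (x * star x)
  faithful : ∀ x ∈ S, 0 ≤ x → ρ x = 0 → x = 0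
  normal : ∀ D : Set (H →L[ℂ] H), D ⊆ S → (∀ d ∈ D, 0 ≤ d) → D.Nonempty →
    DirectedOn (· ≤ ·) D → ∀ x ∈ S, IsLUB D x → ρ x = ⨆ d ∈ D, ρ d
  semifinite : IsSemifinite S ρ

/-- `Proj(S)`, the set of orthogonal projections in `S`. -/
def projections (S : Set (H →L[ℂ] H)) : Set (H →L[ℂ] H) :=
  {P | P ∈ S ∧ IsStarProjection P}

/-- `𝒫(S)`, the set of orthogonal projections of finite trace in `S`. -/
def finProjections (S : Set (H →L[ℂ] H)) (ρ : (H →L[ℂ] H) → ℝ≥0∞) : Set (H →L[ℂ] H) :=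
  {P | P ∈ projections S ∧ ρ P < ⊤}

/-- The minimal projections of `S`. -/
def minProjections (S : Set (H →L[ℂ] H)) : Set (H →L[ℂ] H) :=
  {P | P ∈ projections S ∧ P ≠ 0 ∧ ∀ R ∈ projections S, R ≤ P → R = 0 ∨ R = P}

/-- `S` is generated, as a von Neumann algebra, by its minimal projections. -/
def IsAtomic (S : Set (H →L[ℂ] H)) : Prop :=
  Set.centralizer (Set.centralizer (minProjections S)) = S

/-- `S` has no minimal projections. -/
def IsDiffuse (S : Set (H →L[ℂ] H)) : Prop :=
  minProjections S = ∅

/-- `ℛ⁺₁(S)`: the positive contractions `a` in `S` of finite `ρ`-rank, that is with `a P = a` for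
some projection `P ∈ S` of finite trace. -/
def finRankContractions (S : Set (H →L[ℂ] H)) (ρ : (H →L[ℂ] H) → ℝ≥0∞) : Set (H →L[ℂ] H) :=
  {a | a ∈ S ∧ 0 ≤ a ∧ a ≤ 1 ∧ ∃ P ∈ finProjections S ρ, a * P = a}

/-- `L¹(S, ρ) ∩ S`: the elements `x` of `S` with `ρ(|x|) < ∞`. -/
def boundedL1 (S : Set (H →L[ℂ] H)) (ρ : (H →L[ℂ] H) → ℝ≥0∞) : Set (H →L[ℂ] H) :=
  {x | x ∈ S ∧ ρ (CFC.abs x) < ⊤}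

/-- The norm `|x|₁ = ρ(|x|)`, for `x ∈ L¹(S, ρ) ∩ S`. -/
noncomputable def norm1 (ρ : (H →L[ℂ] H) → ℝ≥0∞) (x : H →L[ℂ] H) : ℝ :=
  (ρ (CFC.abs x)).toReal

/-- The norm of `x ∈ L¹(S, ρ) ∩ S` in `L¹ + L^∞`: the infimum of `|y|₁ + ‖z‖` over all
decompositions `x = y + z` (here `y = x - z` is necessarily in `L¹(S, ρ) ∩ S`). -/
noncomputable def normSum (S : Set (H →L[ℂ] H)) (ρ : (H →L[ℂ] H) → ℝ≥0∞) (x : H →L[ℂ] H) : ℝ :=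
  sInf {r : ℝ | ∃ y ∈ boundedL1 S ρ, r = norm1 ρ y + ‖x - y‖}

/-- The generalized singular values
`μ(t, x) = inf { ‖x (1 - P)‖ : P ∈ 𝒫(S), ρ(P) ≤ t }`, for `t > 0`. -/
noncomputable def genSingularValue (S : Set (H →L[ℂ] H)) (ρ : (H →L[ℂ] H) → ℝ≥0∞)
    (t : ℝ) (x : H →L[ℂ] H) : ℝ :=
  sInf {r : ℝ | ∃ P ∈ finProjections S ρ, ρ P ≤ ENNReal.ofReal t ∧ r = ‖x * (1 - P)‖}

/-- `J` is a norm on `L¹(S, ρ) ∩ S` which is monotone in the generalized singular values, lies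
between the norms of `L¹ + L^∞` and `L¹ ∩ L^∞` up to constants, and tends to zero along
projections whose trace tends to zero. (Only the values of `J` on `L¹(S, ρ) ∩ S` matter.) -/
structure IsSymmetricNorm (S : Set (H →L[ℂ] H)) (ρ : (H →L[ℂ] H) → ℝ≥0∞)
    (J : (H →L[ℂ] H) → ℝ) : Prop where
  add_le : ∀ x ∈ boundedL1 S ρ, ∀ y ∈ boundedL1 S ρ, J (x + y) ≤ J x + J y
  smul : ∀ (c : ℂ), ∀ x ∈ boundedL1 S ρ, J (c • x) = ‖c‖ * J x
  eq_zero : ∀ x ∈ boundedL1 S ρ, J x = 0 → x = 0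
  mono : ∀ x ∈ boundedL1 S ρ, ∀ y ∈ boundedL1 S ρ,
    (∀ t : ℝ, 0 < t → genSingularValue S ρ t x ≤ genSingularValue S ρ t y) → J x ≤ J y
  bounds : ∃ C₁ C₂ : ℝ, 0 < C₁ ∧ 0 < C₂ ∧ ∀ x ∈ boundedL1 S ρ,
    C₁ * normSum S ρ x ≤ J x ∧ J x ≤ C₂ * (norm1 ρ x + ‖x‖)
  small : ∀ P : ℕ → (H →L[ℂ] H), (∀ k, P k ∈ finProjections S ρ) →
    Tendsto (fun k => ρ (P k)) atTop (𝓝 0) → Tendsto (fun k => J (P k)) atTop (𝓝 0)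

/-- The coordinate projection `H^m → H`; its adjoint is the coordinate embedding `H → H^m`. -/
noncomputable def coord (H : Type u) [NormedAddCommGroup H] [InnerProductSpace ℂ H]
    {m : ℕ} (i : Fin m) : PiLp 2 (fun _ : Fin m => H) →L[ℂ] H :=
  PiLp.proj 2 (fun _ : Fin m => H) i

/-- The `(i, j)` matrix entry of an operator on `H^m`. -/
noncomputable def entry {m : ℕ}
    (X : PiLp 2 (fun _ : Fin m => H) →L[ℂ] PiLp 2 (fun _ : Fin m => H)) (i j : Fin m) :
    H →L[ℂ] H :=
  coord H i ∘L X ∘L ContinuousLinearMap.adjoint (coord H j)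

/-- `S ⊗ M_m`, acting on `H^m`: the operators all of whose matrix entries are in `S`. -/
def ampSet (S : Set (H →L[ℂ] H)) (m : ℕ) :
    Set (PiLp 2 (fun _ : Fin m => H) →L[ℂ] PiLp 2 (fun _ : Fin m => H)) :=
  {X | ∀ i j, entry X i j ∈ S}

/-- The trace `ρ ⊗ Tr_m` on `S ⊗ M_m`. -/
noncomputable def ampTrace (ρ : (H →L[ℂ] H) → ℝ≥0∞) (m : ℕ)
    (X : PiLp 2 (fun _ : Fin m => H) →L[ℂ] PiLp 2 (fun _ : Fin m => H)) : ℝ≥0∞ :=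
  ∑ i, ρ (entry X i i)

/-- The operator `x ⊗ e₁₁` on `H^(m+1)`. -/
noncomputable def corner (m : ℕ) (x : H →L[ℂ] H) :
    PiLp 2 (fun _ : Fin (m + 1) => H) →L[ℂ] PiLp 2 (fun _ : Fin (m + 1) => H) :=
  ContinuousLinearMap.adjoint (coord H (0 : Fin (m + 1))) ∘L x ∘L coord H (0 : Fin (m + 1))

/-- `J` is a symmetric operator norm on `L¹(S, ρ) ∩ S`: a symmetric norm which, for all `m`, extends
from `S ≅ S ⊗ e₁₁` to a symmetric norm for `S ⊗ M_m` with the trace `ρ ⊗ Tr_m`. -/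
structure IsSymmetricOperatorNorm (S : Set (H →L[ℂ] H)) (ρ : (H →L[ℂ] H) → ℝ≥0∞)
    (J : (H →L[ℂ] H) → ℝ) : Prop extends IsSymmetricNorm S ρ J where
  amplification : ∀ m : ℕ,
    ∃ J' : (PiLp 2 (fun _ : Fin (m + 1) => H) →L[ℂ] PiLp 2 (fun _ : Fin (m + 1) => H)) → ℝ,
      IsSymmetricNorm (ampSet S (m + 1)) (ampTrace ρ (m + 1)) J' ∧
      ∀ x ∈ boundedL1 S ρ, J' (corner m x) = J x

end Basics

section Modulus

variable {H : Type u} [NormedAddCommGroup H] [InnerProductSpace ℂ H] [CompleteSpace H]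

/-- The `*`-automorphisms of a von Neumann algebra. -/
abbrev Aut (M : VonNeumannAlgebra H) : Type u :=
  M.toStarSubalgebra ≃⋆ₐ[ℂ] M.toStarSubalgebra

/-- `α` preserves the trace `ρ`. -/
def PreservesTrace {M : VonNeumannAlgebra H} (ρ : (H →L[ℂ] H) → ℝ≥0∞) (α : Aut M) : Prop :=
  ∀ x : M.toStarSubalgebra, 0 ≤ (x : H →L[ℂ] H) → ρ (α x : H →L[ℂ] H) = ρ (x : H →L[ℂ] H)

/-- The condenser quasicentral modulus for projections `P, Q` of finite trace:
the infimum of `max_j |α_j(A) - A|_J` over the `A ∈ ℛ⁺₁(M)` with `A P = P` and `A Q = 0`. -/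
noncomputable def finModulus (M : VonNeumannAlgebra H) (ρ : (H →L[ℂ] H) → ℝ≥0∞)
    (J : (H →L[ℂ] H) → ℝ) {n : ℕ} (α : Fin n → Aut M) (P Q : H →L[ℂ] H) : ℝ≥0∞ :=
  ⨅ (A : M.toStarSubalgebra) (_ : (A : H →L[ℂ] H) ∈ finRankContractions (M : Set (H →L[ℂ] H)) ρ ∧
      (A : H →L[ℂ] H) * P = P ∧ (A : H →L[ℂ] H) * Q = 0),
    ⨆ j, ENNReal.ofReal (J ((α j A : H →L[ℂ] H) - (A : H →L[ℂ] H)))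

/-- The condenser quasicentral modulus `k_{J,M}(α; P, Q) ∈ [0, ∞]` for arbitrary projections `P, Q`:
the supremum of the moduli over the subprojections `P' ≤ P`, `Q' ≤ Q` in `M` of finite trace. -/
noncomputable def modulus (M : VonNeumannAlgebra H) (ρ : (H →L[ℂ] H) → ℝ≥0∞)
    (J : (H →L[ℂ] H) → ℝ) {n : ℕ} (α : Fin n → Aut M) (P Q : H →L[ℂ] H) : ℝ≥0∞ :=
  ⨆ (P' ∈ finProjections (M : Set (H →L[ℂ] H)) ρ) (Q' ∈ finProjections (M : Set (H →L[ℂ] H)) ρ)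
    (_ : P' ≤ P ∧ Q' ≤ Q), finModulus M ρ J α P' Q'

/-- The inclusion of a von Neumann subalgebra `N` (with the same unit) in `M`. -/
noncomputable def incl {M N : VonNeumannAlgebra H} (hNM : N ≤ M) : N.toStarSubalgebra →⋆ₐ[ℂ] M.toStarSubalgebra :=
  StarSubalgebra.inclusion (S₁ := N.toStarSubalgebra) (S₂ := M.toStarSubalgebra) (fun _ hx => hNM hx)

/-- `α(N) = N`. -/
def MapsOnto {M N : VonNeumannAlgebra H} (hNM : N ≤ M) (α : Aut M) : Prop :=
  Set.range (fun x : N.toStarSubalgebra => (α (incl hNM x) : H →L[ℂ] H)) = (N : Set (H →L[ℂ] H))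

/-- The restriction of `α` to an automorphism `α|N` of `N`, when `α(N) = N`. -/
noncomputable def restrictAut {M N : VonNeumannAlgebra H} (hNM : N ≤ M) (α : Aut M)
    (h : MapsOnto hNM α) : Aut N :=
  StarAlgEquiv.ofBijective
    ({ toFun := fun x => ⟨(α (incl hNM x) : H →L[ℂ] H), h.subset ⟨x, rfl⟩⟩
       map_one' := by ext1; simp
       map_mul' := fun x y => by ext1; simp
       map_zero' := by ext1; simp
       map_add' := fun x y => by ext1; simp
       commutes' := fun c => by
        ext1
        have h1 : incl hNM (algebraMap ℂ N.toStarSubalgebra c) = algebraMap ℂ M.toStarSubalgebra c :=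
          rfl
        simpa [h1] using congrArg (Subtype.val) (AlgEquivClass.commutes α c)
       map_star' := fun x => by ext1; simp [map_star] } :
      N.toStarSubalgebra →⋆ₐ[ℂ] N.toStarSubalgebra)
    (by
      constructor
      · intro x y hxy
        have h1 : (α (incl hNM x) : H →L[ℂ] H) = α (incl hNM y) :=
          congrArg (fun z : N.toStarSubalgebra => (z : H →L[ℂ] H)) hxy
        have h2 := α.injective (Subtype.ext h1)
        exact Subtype.ext (congrArg (fun z : M.toStarSubalgebra => (z : H →L[ℂ] H)) h2)
      · intro y
        obtain ⟨x, hx⟩ := h.symm.subset y.2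
        exact ⟨x, Subtype.ext hx⟩)

theorem coe_restrictAut {M N : VonNeumannAlgebra H} (hNM : N ≤ M) (α : Aut M)
    (h : MapsOnto hNM α) (x : N.toStarSubalgebra) :
    (restrictAut hNM α h x : H →L[ℂ] H) = (α (incl hNM x) : H →L[ℂ] H) := rfl

/-- `E` is the conditional expectation of `M` onto `N` with respect to `ρ`: a positive linear
`N`-bimodule projection of `M` onto `N` with `ρ ∘ E = ρ`. -/
structure IsConditionalExpectation {M N : VonNeumannAlgebra H} (hNM : N ≤ M)
    (ρ : (H →L[ℂ] H) → ℝ≥0∞) (E : M.toStarSubalgebra →ₗ[ℂ] N.toStarSubalgebra) : Prop where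
  map_incl : ∀ a : N.toStarSubalgebra, E (incl hNM a) = a
  bimodule : ∀ (a b : N.toStarSubalgebra) (x : M.toStarSubalgebra),
    E (incl hNM a * x * incl hNM b) = a * E x * b
  nonneg : ∀ x : M.toStarSubalgebra, 0 ≤ (x : H →L[ℂ] H) → 0 ≤ (E x : H →L[ℂ] H)
  trace_eq : ∀ x : M.toStarSubalgebra, 0 ≤ (x : H →L[ℂ] H) →
    ρ (E x : H →L[ℂ] H) = ρ (x : H →L[ℂ] H)

end Modulus

end Condenser

namespace Condenser

universe u

variable {H : Type u} [NormedAddCommGroup H] [InnerProductSpace ℂ H] [CompleteSpace H]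

/-! Everything rests on one continuity property of the norm: a positive element with a fixed
operator bound and small trace has small `J` (`exists_nonneg_small`). Hence replacing a competitor
`B` by `B'` with `B' - B = a - b`, where `a, b ≥ 0` have small trace, changes every `J (β B - B)`
only slightly (`exists_perturbation`). A first consequence is that competitors of finite trace,
rather than finite rank, already bound the modulus (`finModulus_le_iSup`): truncate spectrally and
rescale.

The modulus of `N` is at most that of `M`: for a competitor `A` in `M`, the element `E A` is a
finite-trace competitor in `N`, and `E` commutes with each `α j` on positive elements of finite
trace (`map_aut`), so that `α j (E A) - E A = E (α j A - A)` has no larger norm.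

The modulus of `M` is at most that of `N`: finite projections `p ≤ P`, `q ≤ Q` of `M` need not lie
below finite projections of `N`. Semifiniteness of `N` and normality of the trace still give finite
`P₁ ≤ P`, `Q₁ ≤ Q` in `N` that almost contain them in trace
(`exists_finProjection_trace_conj_sub_le`). A nearly optimal `A` for `P₁, Q₁` is then corrected to
be exactly `1` on `p` and `0` on `q`. The correction is small in the Hilbert-Schmidt sense and
carried by the finite projection `p + q`, hence is a difference of positive elements of small trace
(`exists_modification`). -/

noncomputable instance : Algebra ℝ (H →L[ℂ] H) := inferInstance
noncomputable instance : Module ℝ (H →L[ℂ] H) := inferInstance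
noncomputable instance : MulAction ℝ (H →L[ℂ] H) := inferInstance
noncomputable instance : SMul ℝ (H →L[ℂ] H) := inferInstance
instance : NonUnitalContinuousFunctionalCalculus ℝ (H →L[ℂ] H) IsSelfAdjoint := inferInstance
instance : NonnegSpectrumClass ℝ (H →L[ℂ] H) := inferInstance
noncomputable instance : PosPart (H →L[ℂ] H) := inferInstance
noncomputable instance : NegPart (H →L[ℂ] H) := inferInstance
instance : T2Space (H →L[ℂ] H) := inferInstance

/-! ### Membership in a von Neumann algebra, and range projections -/

/-- By the double commutant property, anything built canonically from elements of `M` (continuous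
functions, range projections) lies in `M`. -/
theorem mem_of_commute {M : VonNeumannAlgebra H} {x : H →L[ℂ] H}
    (h : ∀ T ∈ M.commutant, Commute T x) : x ∈ M := by
  rw [← M.commutant_commutant, VonNeumannAlgebra.mem_commutant_iff]
  exact h

theorem commute_of_mem_commutant {M : VonNeumannAlgebra H} {x T : H →L[ℂ] H} (hx : x ∈ M)
    (hT : T ∈ M.commutant) : Commute T x :=
  (VonNeumannAlgebra.mem_commutant_iff.1 hT x hx).symm

theorem real_smul_mem {M : VonNeumannAlgebra H} {x : H →L[ℂ] H} (c : ℝ) (hx : x ∈ M) :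
    c • x ∈ M := by
  have : c • x = (c : ℂ) • x := by simp
  rw [this]
  exact M.toStarSubalgebra.smul_mem hx (c : ℂ)

theorem posPart_mem {M : VonNeumannAlgebra H} {x : H →L[ℂ] H} (hx : x ∈ M) : x⁺ ∈ M :=
  mem_of_commute fun _ hT => ((commute_of_mem_commutant hx hT).symm.cfcₙ_real _).symm

theorem negPart_mem {M : VonNeumannAlgebra H} {x : H →L[ℂ] H} (hx : x ∈ M) : x⁻ ∈ M :=
  mem_of_commute fun _ hT => ((commute_of_mem_commutant hx hT).symm.cfcₙ_real _).symm

theorem sqrt_mem {M : VonNeumannAlgebra H} {x : H →L[ℂ] H} (hx : x ∈ M) : CFC.sqrt x ∈ M :=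
  mem_of_commute fun _ hT => ((commute_of_mem_commutant hx hT).symm.cfcₙ_nnreal _).symm

theorem starProjection_mem {M : VonNeumannAlgebra H} {K : Submodule ℂ H} [K.HasOrthogonalProjection]
    (h : ∀ T ∈ M.commutant, ∀ v ∈ K, T v ∈ K) : K.starProjection ∈ M := by
  rw [VonNeumannAlgebra.IsStarProjection.mem_iff isStarProjection_starProjection]
  intro T hT
  rw [Submodule.range_starProjection]
  exact fun v hv => h T hT v hv

/-- The projection onto the closure of the range of an operator. -/
noncomputable def rangeProj (a : H →L[ℂ] H) : H →L[ℂ] H :=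
  a.range.topologicalClosure.starProjection

theorem isStarProjection_rangeProj (a : H →L[ℂ] H) : IsStarProjection (rangeProj a) :=
  isStarProjection_starProjection

theorem rangeProj_mem {M : VonNeumannAlgebra H} {a : H →L[ℂ] H} (ha : a ∈ M) : rangeProj a ∈ M := by
  refine starProjection_mem fun T hT v hv => ?_
  refine map_mem_closure T.continuous hv ?_
  rintro _ ⟨w, rfl⟩
  refine ⟨T w, ?_⟩
  exact (DFunLike.congr_fun (commute_of_mem_commutant ha hT).eq w).symm

theorem rangeProj_mul (a : H →L[ℂ] H) : rangeProj a * a = a := by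
  ext v
  exact Submodule.starProjection_eq_self_iff.2 (Submodule.le_topologicalClosure _ ⟨v, rfl⟩)

theorem mul_rangeProj_eq_zero {a b : H →L[ℂ] H} (h : b * a = 0) : b * rangeProj a = 0 := by
  ext v
  have h1 : rangeProj a v ∈ a.range.topologicalClosure := Submodule.starProjection_apply_mem _ _
  have h2 : a.range.topologicalClosure ≤ b.ker := by
    refine Submodule.topologicalClosure_minimal _ ?_ b.isClosed_ker
    rintro _ ⟨w, rfl⟩
    exact DFunLike.congr_fun h w
  exact h2 h1

theorem mul_rangeProj {a : H →L[ℂ] H} (ha : IsSelfAdjoint a) : a * rangeProj a = a := by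
  have := congrArg star (rangeProj_mul a)
  rwa [star_mul, ha.star_eq, (isStarProjection_rangeProj a).isSelfAdjoint.star_eq] at this

theorem rangeProj_mul_eq_zero {a b : H →L[ℂ] H} (hb : IsSelfAdjoint b)
    (h : b * a = 0) : rangeProj a * b = 0 := by
  have := congrArg star (mul_rangeProj_eq_zero h)
  rwa [star_mul, hb.star_eq, (isStarProjection_rangeProj a).isSelfAdjoint.star_eq, star_zero] at this

theorem isSelfAdjoint_posPart (y : H →L[ℂ] H) : IsSelfAdjoint y⁺ :=
  .of_nonneg (CFC.posPart_nonneg y)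

theorem isSelfAdjoint_negPart (y : H →L[ℂ] H) : IsSelfAdjoint y⁻ :=
  .of_nonneg (CFC.negPart_nonneg y)

theorem negPart_mul_rangeProj_posPart (y : H →L[ℂ] H) : y⁻ * rangeProj y⁺ = 0 :=
  mul_rangeProj_eq_zero (CFC.negPart_mul_posPart y)

/-- Since `rangeProj y⁺` fixes `y⁺` and kills `y⁻`, it plays the role of the spectral projection of
`y` for `(0, ∞)`. Compressing by it turns inequalities for `y` into inequalities for `y⁺`. -/
theorem rangeProj_posPart_mul_mul {y : H →L[ℂ] H} (hy : IsSelfAdjoint y) :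
    rangeProj y⁺ * y * rangeProj y⁺ = y⁺ := by
  have h : rangeProj y⁺ * (y⁺ - y⁻) * rangeProj y⁺ = y⁺ := by
    rw [mul_sub, sub_mul, rangeProj_mul, mul_rangeProj (isSelfAdjoint_posPart y), mul_assoc,
      negPart_mul_rangeProj_posPart, mul_zero, sub_zero]
  rwa [CFC.posPart_sub_negPart y hy] at h

/-! ### Operator inequalities and spectral truncation -/

section Order

theorem conj_le_conj {a b s : H →L[ℂ] H} (hs : IsSelfAdjoint s) (h : a ≤ b) :
    s * a * s ≤ s * b * s := by
  simpa [hs.star_eq] using star_left_conjugate_le_conjugate h s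

theorem conj_nonneg {a s : H →L[ℂ] H} (hs : IsSelfAdjoint s) (h : 0 ≤ a) : 0 ≤ s * a * s := by
  simpa [hs.star_eq] using star_left_conjugate_nonneg h s

theorem posPart_le_smul_rangeProj {y : H →L[ℂ] H} (hy : IsSelfAdjoint y) {c : ℝ}
    (h : y ≤ c • (1 : H →L[ℂ] H)) : y⁺ ≤ c • rangeProj y⁺ := by
  have hs := isStarProjection_rangeProj y⁺
  have := conj_le_conj hs.isSelfAdjoint h
  rwa [rangeProj_posPart_mul_mul hy, mul_smul_comm, mul_one, smul_mul_assoc,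
    hs.isIdempotentElem.eq] at this

theorem posPart_le_smul_one {y : H →L[ℂ] H} (hy : IsSelfAdjoint y) {c : ℝ} (hc : 0 ≤ c)
    (h : y ≤ c • (1 : H →L[ℂ] H)) : y⁺ ≤ c • (1 : H →L[ℂ] H) :=
  (posPart_le_smul_rangeProj hy h).trans
    (smul_le_smul_of_nonneg_left (isStarProjection_rangeProj _).le_one hc)

theorem commute_rangeProj_posPart {y : H →L[ℂ] H} (hy : IsSelfAdjoint y) :
    Commute (rangeProj y⁺) y := by
  have h1 : rangeProj y⁺ * (y⁺ - y⁻) = y⁺ := by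
    rw [mul_sub, rangeProj_mul,
      rangeProj_mul_eq_zero (isSelfAdjoint_negPart y) (CFC.negPart_mul_posPart y), sub_zero]
  have h2 : (y⁺ - y⁻) * rangeProj y⁺ = y⁺ := by
    rw [sub_mul, mul_rangeProj (isSelfAdjoint_posPart y), negPart_mul_rangeProj_posPart, sub_zero]
  rw [CFC.posPart_sub_negPart y hy] at h1 h2
  exact h1.trans h2.symm

theorem conj_le_of_commute {a s : H →L[ℂ] H} (hs : IsStarProjection s) (ha : 0 ≤ a)
    (h : Commute s a) : s * a * s ≤ a := by
  have h1 := conj_nonneg hs.one_sub.isSelfAdjoint ha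
  have h2 : (1 - s) * a * (1 - s) = a - s * a * s := by
    have h3 : a * s = s * a := h.eq.symm
    have h4 : s * s = s := hs.isIdempotentElem.eq
    have h5 : s * a * s = s * a := by rw [mul_assoc, h3, ← mul_assoc, h4]
    rw [sub_mul, one_mul, mul_sub, mul_one, sub_mul, h3, h5]
    abel
  rw [h2] at h1
  exact sub_nonneg.1 h1

/-- The positive part of `b - ε`. -/
noncomputable def cut (ε : ℝ) (b : H →L[ℂ] H) : H →L[ℂ] H := (b - ε • (1 : H →L[ℂ] H))⁺

theorem isSelfAdjoint_sub_smul_one {b : H →L[ℂ] H} (hb : 0 ≤ b) (ε : ℝ) :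
    IsSelfAdjoint (b - ε • (1 : H →L[ℂ] H)) :=
  (IsSelfAdjoint.of_nonneg hb).sub (.smul (.all ε) (.one _))

theorem cut_mem {M : VonNeumannAlgebra H} {b : H →L[ℂ] H} (hb : b ∈ M) (ε : ℝ) : cut ε b ∈ M :=
  posPart_mem (sub_mem hb (real_smul_mem ε (one_mem M)))

theorem cut_nonneg (ε : ℝ) (b : H →L[ℂ] H) : 0 ≤ cut ε b := CFC.posPart_nonneg _

theorem negPart_sub_smul_one_le {b : H →L[ℂ] H} (hb : 0 ≤ b) {ε : ℝ} (hε : 0 ≤ ε) :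
    (b - ε • (1 : H →L[ℂ] H))⁻ ≤ ε • (1 : H →L[ℂ] H) := by
  rw [← CFC.posPart_neg]
  refine posPart_le_smul_one (isSelfAdjoint_sub_smul_one hb ε).neg hε ?_
  rw [neg_sub]
  exact sub_le_self _ hb

theorem sub_cut {b : H →L[ℂ] H} (hb : 0 ≤ b) (ε : ℝ) :
    b - cut ε b = ε • (1 : H →L[ℂ] H) - (b - ε • (1 : H →L[ℂ] H))⁻ := by
  have := CFC.posPart_sub_negPart _ (isSelfAdjoint_sub_smul_one hb ε)
  rw [cut, eq_sub_iff_add_eq, sub_add_eq_add_sub, add_comm, ← sub_add_eq_add_sub,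
    ← neg_sub, this]
  abel

theorem sub_cut_nonneg {b : H →L[ℂ] H} (hb : 0 ≤ b) {ε : ℝ} (hε : 0 ≤ ε) : 0 ≤ b - cut ε b := by
  rw [sub_cut hb]
  exact sub_nonneg.2 (negPart_sub_smul_one_le hb hε)

theorem cut_le {b : H →L[ℂ] H} (hb : 0 ≤ b) {ε : ℝ} (hε : 0 ≤ ε) : cut ε b ≤ b :=
  sub_nonneg.1 (sub_cut_nonneg hb hε)

theorem sub_cut_le_self {b : H →L[ℂ] H} (ε : ℝ) : b - cut ε b ≤ b :=
  sub_le_self _ (cut_nonneg ε b)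

theorem sub_cut_le {b : H →L[ℂ] H} (hb : 0 ≤ b) (ε : ℝ) : b - cut ε b ≤ ε • (1 : H →L[ℂ] H) := by
  rw [sub_cut hb]
  exact sub_le_self _ (CFC.negPart_nonneg _)

theorem cut_le_smul_rangeProj {b : H →L[ℂ] H} (hb : 0 ≤ b) {c ε : ℝ}
    (h : b ≤ c • (1 : H →L[ℂ] H)) : cut ε b ≤ (c - ε) • rangeProj (cut ε b) := by
  refine posPart_le_smul_rangeProj (isSelfAdjoint_sub_smul_one hb ε) ?_
  rw [sub_smul]
  exact sub_le_sub_right h _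

/-- Operator form of Chebyshev's inequality. The projection `s` commutes with `b`, so `b ≥ s b s =
cut ε b + ε s`. -/
theorem smul_rangeProj_cut_le {b : H →L[ℂ] H} (hb : 0 ≤ b) (ε : ℝ) :
    ε • rangeProj (cut ε b) ≤ b := by
  set y := b - ε • (1 : H →L[ℂ] H) with hy
  have hya : IsSelfAdjoint y := isSelfAdjoint_sub_smul_one hb ε
  have hs := isStarProjection_rangeProj (cut ε b)
  have h1 := conj_le_of_commute hs hb (by
    have h2 : Commute (rangeProj (cut ε b)) (y + ε • (1 : H →L[ℂ] H)) :=
      (commute_rangeProj_posPart hya).add_right ((Commute.one_right _).smul_right ε)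
    rwa [hy, sub_add_cancel] at h2)
  refine le_trans ?_ h1
  have h3 : rangeProj (cut ε b) * y * rangeProj (cut ε b) = cut ε b := rangeProj_posPart_mul_mul hya
  rw [hy, mul_sub, sub_mul, mul_smul_comm, mul_one, smul_mul_assoc, hs.isIdempotentElem.eq] at h3
  rw [sub_eq_iff_eq_add.1 h3]
  exact le_add_of_nonneg_left (cut_nonneg ε b)

/-- With `s` the range projection of `cut δ b`, which commutes with `cut ε b`, one has `cut ε b ≥ s
(cut ε b) s ≥ s (b - ε) s = cut δ b + (δ - ε) s`. -/
theorem cut_anti {b : H →L[ℂ] H} (hb : 0 ≤ b) {ε δ : ℝ} (h : ε ≤ δ) : cut δ b ≤ cut ε b := by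
  have hd := isSelfAdjoint_sub_smul_one hb δ
  have he := isSelfAdjoint_sub_smul_one hb ε
  have hs := isStarProjection_rangeProj (cut δ b)
  have heq : b - ε • (1 : H →L[ℂ] H) = (b - δ • (1 : H →L[ℂ] H)) + (δ - ε) • (1 : H →L[ℂ] H) := by
    rw [sub_smul]; abel
  have h1 : Commute (rangeProj (cut δ b)) (b - ε • (1 : H →L[ℂ] H)) := by
    rw [heq]
    exact (commute_rangeProj_posPart hd).add_right ((Commute.one_right _).smul_right _)
  have h2 : Commute (rangeProj (cut δ b)) (cut ε b) := (h1.symm.cfcₙ_real _).symm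
  refine le_trans ?_ (conj_le_of_commute hs (cut_nonneg ε b) h2)
  refine le_trans ?_ (conj_le_conj hs.isSelfAdjoint (CFC.le_posPart he))
  have h3 : rangeProj (cut δ b) * (b - δ • (1 : H →L[ℂ] H)) * rangeProj (cut δ b) = cut δ b :=
    rangeProj_posPart_mul_mul hd
  rw [heq, mul_add, add_mul, h3, mul_smul_comm, mul_one, smul_mul_assoc, hs.isIdempotentElem.eq]
  exact le_add_of_nonneg_right (smul_nonneg (sub_nonneg.2 h) hs.nonneg)

/-- For `y = b - ε`, the identity `y⁻ y⁻ = -y⁻ y` gives `(y⁻ p)* (y⁻ p) = -(1 - ε) p y⁻ p ≤ 0`, so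
`y⁻ p = 0` and `y⁺ p = y p`. The factor `1 - ε` is later removed by rescaling. -/
theorem cut_mul_of_mul_eq_self {b p : H →L[ℂ] H} (hb : 0 ≤ b) (hp : IsStarProjection p)
    (h : b * p = p) {ε : ℝ} (hε : ε ≤ 1) : cut ε b * p = (1 - ε) • p := by
  set y := b - ε • (1 : H →L[ℂ] H) with hy
  have hya : IsSelfAdjoint y := isSelfAdjoint_sub_smul_one hb ε
  have hyp : y * p = (1 - ε) • p := by
    rw [hy, sub_mul, h, smul_mul_assoc, one_mul, sub_smul, one_smul]
  have h1 : y⁻ * y = -(y⁻ * y⁻) := by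
    have : y⁻ * (y⁺ - y⁻) = -(y⁻ * y⁻) := by
      rw [mul_sub, CFC.negPart_mul_posPart, zero_sub]
    rwa [CFC.posPart_sub_negPart y hya] at this
  have h2 : y⁻ * p = 0 := by
    rw [← CStarRing.star_mul_self_eq_zero_iff, star_mul, hp.isSelfAdjoint.star_eq,
      (isSelfAdjoint_negPart y).star_eq]
    have h3 : p * y⁻ * (y⁻ * p) = -((1 - ε) • (p * y⁻ * p)) := by
      have : p * (y⁻ * y) * p = p * y⁻ * (y * p) := by simp only [mul_assoc]
      rw [h1, hyp, mul_smul_comm] at this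
      rw [← this]
      simp only [mul_assoc, mul_neg, neg_mul, neg_neg]
    refine le_antisymm ?_ ?_
    · rw [h3]
      exact neg_nonpos.2 (smul_nonneg (sub_nonneg.2 hε)
        (conj_nonneg hp.isSelfAdjoint (CFC.negPart_nonneg y)))
    · have := star_mul_self_nonneg (y⁻ * p)
      rwa [star_mul, hp.isSelfAdjoint.star_eq, (isSelfAdjoint_negPart y).star_eq] at this
  have h4 : (y⁺ - y⁻) * p = (1 - ε) • p := by rwa [CFC.posPart_sub_negPart y hya]
  rwa [sub_mul, h2, sub_zero] at h4

theorem cut_mul_eq_zero {b p : H →L[ℂ] H} (hb : 0 ≤ b) (h : b * p = 0) {ε : ℝ} (hε : 0 ≤ ε) :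
    cut ε b * p = 0 := by
  have h1 : star p * cut ε b * p = 0 := by
    refine le_antisymm ?_ (star_left_conjugate_nonneg (cut_nonneg ε b) p)
    refine (star_left_conjugate_le_conjugate (cut_le hb hε) p).trans ?_
    rw [mul_assoc, h, mul_zero]
  have h2 : CFC.sqrt (cut ε b) * p = 0 := by
    rw [← CStarRing.star_mul_self_eq_zero_iff, star_mul,
      (IsSelfAdjoint.of_nonneg (CFC.sqrt_nonneg (cut ε b))).star_eq, ← h1]
    conv_rhs => rw [← CFC.sqrt_mul_sqrt_self (cut ε b) (cut_nonneg ε b)]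
    simp only [mul_assoc]
  rw [← CFC.sqrt_mul_sqrt_self (cut ε b) (cut_nonneg ε b), mul_assoc, h2, mul_zero]

end Order

/-! ### Inequalities for the trace, and normality -/

section Trace

variable {M : VonNeumannAlgebra H} {ρ : (H →L[ℂ] H) → ℝ≥0∞}

namespace IsFaithfulNormalSemifiniteTrace

theorem map_zero (hρ : IsFaithfulNormalSemifiniteTrace (M : Set (H →L[ℂ] H)) ρ) : ρ 0 = 0 := by
  simpa using hρ.map_smul 0 0 (zero_mem M) le_rfl

theorem map_real_smul (hρ : IsFaithfulNormalSemifiniteTrace (M : Set (H →L[ℂ] H)) ρ)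
    {x : H →L[ℂ] H} (hx : x ∈ M) (h : 0 ≤ x) {c : ℝ} (hc : 0 ≤ c) :
    ρ (c • x) = ENNReal.ofReal c * ρ x := by
  have := hρ.map_smul ⟨c, hc⟩ x hx h
  rw [Complex.coe_smul] at this
  rw [ENNReal.ofReal_eq_coe_nnreal hc]
  exact this

theorem map_add_sub (hρ : IsFaithfulNormalSemifiniteTrace (M : Set (H →L[ℂ] H)) ρ)
    {x y : H →L[ℂ] H} (hx : x ∈ M) (hy : y ∈ M) (h : 0 ≤ x) (hxy : x ≤ y) :
    ρ x + ρ (y - x) = ρ y := by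
  rw [← hρ.map_add x hx (y - x) (sub_mem hy hx) h (sub_nonneg.2 hxy), add_sub_cancel]

theorem mono (hρ : IsFaithfulNormalSemifiniteTrace (M : Set (H →L[ℂ] H)) ρ)
    {x y : H →L[ℂ] H} (hx : x ∈ M) (hy : y ∈ M) (h : 0 ≤ x) (hxy : x ≤ y) : ρ x ≤ ρ y :=
  (hρ.map_add_sub hx hy h hxy) ▸ le_self_add

/-- The trace property exchanges `z* a z` for `√a (z z*) √a`, which is at most `a`. -/
theorem conj_le (hρ : IsFaithfulNormalSemifiniteTrace (M : Set (H →L[ℂ] H)) ρ)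
    {a z : H →L[ℂ] H} (ha : a ∈ M) (hz : z ∈ M) (h : 0 ≤ a) (hz1 : z * star z ≤ 1) :
    ρ (star z * a * z) ≤ ρ a := by
  set b := CFC.sqrt a
  have hb : b ∈ M := sqrt_mem ha
  have hbs : star b = b := (IsSelfAdjoint.of_nonneg (CFC.sqrt_nonneg a)).star_eq
  have hbb : b * b = a := CFC.sqrt_mul_sqrt_self a h
  have h1 : star z * a * z = star (b * z) * (b * z) := by
    rw [star_mul, hbs, ← hbb]; simp only [mul_assoc]
  have h2 : b * z * star (b * z) = b * (z * star z) * b := by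
    rw [star_mul, hbs]; simp only [mul_assoc]
  rw [h1, hρ.tracial _ (mul_mem hb hz), h2]
  refine hρ.mono (mul_mem (mul_mem hb (mul_mem hz (star_mem hz))) hb) ha
    (conj_nonneg hbs (mul_star_self_nonneg z)) ?_
  have := conj_le_conj hbs hz1
  rwa [mul_one, hbb] at this

theorem conj_proj_le (hρ : IsFaithfulNormalSemifiniteTrace (M : Set (H →L[ℂ] H)) ρ)
    {a s : H →L[ℂ] H} (ha : a ∈ M) (hs : s ∈ M) (h : 0 ≤ a) (hsp : IsStarProjection s) :
    ρ (s * a * s) ≤ ρ a := by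
  have := hρ.conj_le ha hs h (by
    rw [hsp.isSelfAdjoint.star_eq, hsp.isIdempotentElem.eq]; exact hsp.le_one)
  rwa [hsp.isSelfAdjoint.star_eq] at this

/-- With `s` the range projection, `(a - b)⁺ = s (a - b) s ≤ s a s`. This and its companion for the
negative part replace the triangle inequality for `|·|₁`. -/
theorem posPart_sub_le (hρ : IsFaithfulNormalSemifiniteTrace (M : Set (H →L[ℂ] H)) ρ)
    {a b : H →L[ℂ] H} (ha : a ∈ M) (hb : b ∈ M) (ha0 : 0 ≤ a) (hb0 : 0 ≤ b) :
    ρ (a - b)⁺ ≤ ρ a := by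
  have hy : IsSelfAdjoint (a - b) := (IsSelfAdjoint.of_nonneg ha0).sub (.of_nonneg hb0)
  have hs := isStarProjection_rangeProj (a - b)⁺
  have hsM : rangeProj (a - b)⁺ ∈ M := rangeProj_mem (posPart_mem (sub_mem ha hb))
  refine le_trans ?_ (hρ.conj_proj_le ha hsM ha0 hs)
  refine hρ.mono (posPart_mem (sub_mem ha hb)) (mul_mem (mul_mem hsM ha) hsM)
    (CFC.posPart_nonneg _) ?_
  conv_lhs => rw [← rangeProj_posPart_mul_mul hy]
  exact conj_le_conj hs.isSelfAdjoint (sub_le_self _ hb0)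

theorem negPart_sub_le (hρ : IsFaithfulNormalSemifiniteTrace (M : Set (H →L[ℂ] H)) ρ)
    {a b : H →L[ℂ] H} (ha : a ∈ M) (hb : b ∈ M) (ha0 : 0 ≤ a) (hb0 : 0 ≤ b) :
    ρ (a - b)⁻ ≤ ρ b := by
  rw [← CFC.posPart_neg, neg_sub]
  exact hρ.posPart_sub_le hb ha hb0 ha0

theorem sub_mem_boundedL1 (hρ : IsFaithfulNormalSemifiniteTrace (M : Set (H →L[ℂ] H)) ρ)
    {a b : H →L[ℂ] H} (ha : a ∈ M) (hb : b ∈ M) (ha0 : 0 ≤ a) (hb0 : 0 ≤ b)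
    (hat : ρ a < ⊤) (hbt : ρ b < ⊤) : a - b ∈ boundedL1 (M : Set (H →L[ℂ] H)) ρ := by
  refine ⟨sub_mem ha hb, ?_⟩
  have hy : IsSelfAdjoint (a - b) := (IsSelfAdjoint.of_nonneg ha0).sub (.of_nonneg hb0)
  rw [← CFC.posPart_add_negPart (a - b) hy, hρ.map_add _ (posPart_mem (sub_mem ha hb)) _
    (negPart_mem (sub_mem ha hb)) (CFC.posPart_nonneg _) (CFC.negPart_nonneg _)]
  exact ENNReal.add_lt_top.2 ⟨(hρ.posPart_sub_le ha hb ha0 hb0).trans_lt hat,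
    (hρ.negPart_sub_le ha hb ha0 hb0).trans_lt hbt⟩

theorem mem_boundedL1 (hρ : IsFaithfulNormalSemifiniteTrace (M : Set (H →L[ℂ] H)) ρ)
    {a : H →L[ℂ] H} (ha : a ∈ M) (ha0 : 0 ≤ a) (hat : ρ a < ⊤) :
    a ∈ boundedL1 (M : Set (H →L[ℂ] H)) ρ := by
  simpa using hρ.sub_mem_boundedL1 ha (zero_mem M) ha0 le_rfl hat (by simp [hρ.map_zero])

theorem mul_rangeProj_cut_le (hρ : IsFaithfulNormalSemifiniteTrace (M : Set (H →L[ℂ] H)) ρ)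
    {b : H →L[ℂ] H} (hb : b ∈ M) (hb0 : 0 ≤ b) {ε : ℝ} (hε : 0 ≤ ε) :
    ENNReal.ofReal ε * ρ (rangeProj (cut ε b)) ≤ ρ b := by
  have hR := isStarProjection_rangeProj (cut ε b)
  have hRM : rangeProj (cut ε b) ∈ M := rangeProj_mem (cut_mem hb ε)
  rw [← hρ.map_real_smul hRM hR.nonneg hε]
  exact hρ.mono (real_smul_mem ε hRM) hb (smul_nonneg hε hR.nonneg) (smul_rangeProj_cut_le hb0 ε)

theorem rangeProj_cut_lt_top (hρ : IsFaithfulNormalSemifiniteTrace (M : Set (H →L[ℂ] H)) ρ)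
    {b : H →L[ℂ] H} (hb : b ∈ M) (hb0 : 0 ≤ b) (hbt : ρ b < ⊤) {ε : ℝ} (hε : 0 < ε) :
    ρ (rangeProj (cut ε b)) < ⊤ := by
  have := (hρ.mul_rangeProj_cut_le hb hb0 hε.le).trans_lt hbt
  by_contra h
  rw [not_lt, top_le_iff] at h
  rw [h, ENNReal.mul_top (by simpa using hε)] at this
  exact lt_irrefl _ this

/-- Normality as an approximation statement: if `ρ d + η < ρ x` for all `d`, the supremum would be
at most `ρ x - η < ρ x`. -/
theorem exists_sub_le_of_isLUB (hρ : IsFaithfulNormalSemifiniteTrace (M : Set (H →L[ℂ] H)) ρ)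
    {D : Set (H →L[ℂ] H)} (hD : D ⊆ M) (hD0 : ∀ d ∈ D, 0 ≤ d) (hne : D.Nonempty)
    (hdir : DirectedOn (· ≤ ·) D) {x : H →L[ℂ] H} (hx : x ∈ M) (hlub : IsLUB D x)
    (hxt : ρ x < ⊤) {η : ℝ≥0∞} (hη : η ≠ 0) : ∃ d ∈ D, ρ (x - d) ≤ η := by
  have h := hρ.normal D hD hD0 hne hdir x hx hlub
  have key : ∃ d ∈ D, ρ x ≤ ρ d + η := by
    by_contra! hcon
    obtain ⟨d₀, hd₀⟩ := hne
    have h1 : ρ x ≤ ρ x - η := by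
      conv_lhs => rw [h]
      exact iSup₂_le fun d hd => ENNReal.le_sub_of_add_le_right
        (ne_top_of_le_ne_top hxt.ne (le_add_self.trans (hcon d hd).le)) (hcon d hd).le
    have h2 : ρ x ≠ 0 := fun h0 => by
      have := hcon d₀ hd₀
      simp [h0] at this
    exact absurd h1 (not_le.2 (ENNReal.sub_lt_self hxt.ne h2 hη))
  obtain ⟨d, hd, hle⟩ := key
  refine ⟨d, hd, ?_⟩
  have h3 := hρ.map_add_sub (hD hd) hx (hD0 d hd) (hlub.1 hd)
  rw [← h3] at hle hxt
  exact (ENNReal.add_le_add_iff_left (ENNReal.add_lt_top.1 hxt).1.ne).1 hle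

end IsFaithfulNormalSemifiniteTrace

theorem le_of_forall_sub_smul_one_le {a b : H →L[ℂ] H} {δ : ℝ} (hδ : 0 < δ)
    (h : ∀ ε ∈ Set.Ioo 0 δ, a - ε • (1 : H →L[ℂ] H) ≤ b) : a ≤ b := by
  have h1 : Tendsto (fun ε : ℝ => b - (a - ε • (1 : H →L[ℂ] H))) (𝓝[>] 0)
      (𝓝 (b - (a - (0 : ℝ) • (1 : H →L[ℂ] H)))) :=
    tendsto_nhdsWithin_of_tendsto_nhds (Continuous.tendsto (by fun_prop) 0)
  rw [zero_smul, sub_zero] at h1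
  refine sub_nonneg.1 (CStarAlgebra.isClosed_nonneg.mem_of_tendsto h1 ?_)
  filter_upwards [Ioo_mem_nhdsGT hδ] with ε hε
  exact sub_nonneg.2 (h ε hε)

/-- The truncations increase to `b` as the level decreases to `0`, so normality makes the remainder
small in trace. -/
theorem IsFaithfulNormalSemifiniteTrace.exists_sub_cut_le
    (hρ : IsFaithfulNormalSemifiniteTrace (M : Set (H →L[ℂ] H)) ρ)
    {b : H →L[ℂ] H} (hb : b ∈ M) (hb0 : 0 ≤ b) (hbt : ρ b < ⊤) {η : ℝ≥0∞} (hη : η ≠ 0)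
    {δ : ℝ} (hδ : 0 < δ) : ∃ ε ∈ Set.Ioo 0 δ, ρ (b - cut ε b) ≤ η := by
  have key : ∃ d ∈ (fun ε => cut ε b) '' Set.Ioo 0 δ, ρ (b - d) ≤ η := by
    refine hρ.exists_sub_le_of_isLUB ?_ ?_ ?_ ?_ hb ?_ hbt hη
    · rintro _ ⟨ε, -, rfl⟩
      exact cut_mem hb ε
    · rintro _ ⟨ε, -, rfl⟩
      exact cut_nonneg ε b
    · exact ⟨_, δ / 2, ⟨by linarith, by linarith⟩, rfl⟩
    · rintro _ ⟨ε, hε, rfl⟩ _ ⟨ε', hε', rfl⟩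
      exact ⟨_, ⟨min ε ε', ⟨lt_min hε.1 hε'.1, (min_le_left _ _).trans_lt hε.2⟩, rfl⟩,
        cut_anti hb0 (min_le_left _ _), cut_anti hb0 (min_le_right _ _)⟩
    · refine ⟨?_, fun T hT => le_of_forall_sub_smul_one_le hδ fun ε hε => ?_⟩
      · rintro _ ⟨ε, hε, rfl⟩
        exact cut_le hb0 hε.1.le
      · exact (CFC.le_posPart (isSelfAdjoint_sub_smul_one hb0 ε)).trans (hT ⟨ε, hε, rfl⟩)
  obtain ⟨_, ⟨ε, hε, rfl⟩, h⟩ := key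
  exact ⟨ε, hε, h⟩

end Trace

/-! ### Continuity of the symmetric norm in the trace -/

section Norm

variable {M : VonNeumannAlgebra H} {ρ : (H →L[ℂ] H) → ℝ≥0∞} {J : (H →L[ℂ] H) → ℝ}

theorem norm_le_of_le_smul_one {a : H →L[ℂ] H} (ha : 0 ≤ a) {c : ℝ} (hc : 0 ≤ c)
    (h : a ≤ c • (1 : H →L[ℂ] H)) : ‖a‖ ≤ c := by
  rw [CStarAlgebra.norm_le_iff_le_algebraMap a hc ha, Algebra.algebraMap_eq_smul_one]
  exact h

theorem zero_mem_finProjections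
    (hρ : IsFaithfulNormalSemifiniteTrace (M : Set (H →L[ℂ] H)) ρ) :
    (0 : H →L[ℂ] H) ∈ finProjections (M : Set (H →L[ℂ] H)) ρ :=
  ⟨⟨zero_mem M, .zero _⟩, by simp [hρ.map_zero]⟩

theorem genSingularValue_le (hρ : IsFaithfulNormalSemifiniteTrace (M : Set (H →L[ℂ] H)) ρ)
    {x y : H →L[ℂ] H} (t : ℝ) (h : ∀ P : H →L[ℂ] H, ‖x * (1 - P)‖ ≤ ‖y * (1 - P)‖) :
    genSingularValue (M : Set (H →L[ℂ] H)) ρ t x ≤ genSingularValue (M : Set (H →L[ℂ] H)) ρ t y := by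
  refine le_csInf ⟨_, 0, zero_mem_finProjections hρ, by simp [hρ.map_zero], rfl⟩ ?_
  rintro _ ⟨P, hP, hPt, rfl⟩
  refine le_trans (csInf_le ?_ ⟨P, hP, hPt, rfl⟩) (h P)
  refine ⟨0, ?_⟩
  rintro _ ⟨P, -, -, rfl⟩
  exact norm_nonneg _

namespace IsSymmetricNorm

theorem neg (hJ : IsSymmetricNorm (M : Set (H →L[ℂ] H)) ρ J) {x : H →L[ℂ] H}
    (hx : x ∈ boundedL1 (M : Set (H →L[ℂ] H)) ρ) : J (-x) = J x := by
  simpa using hJ.smul (-1) x hx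

/-- Uniform version of the sequential axiom `small`: counterexamples for `δ = 1 / (k + 1)` would
form a sequence violating it. -/
theorem exists_projection_small (hJ : IsSymmetricNorm (M : Set (H →L[ℂ] H)) ρ J) {ε : ℝ}
    (hε : 0 < ε) : ∃ δ : ℝ, 0 < δ ∧ ∀ P ∈ finProjections (M : Set (H →L[ℂ] H)) ρ,
      ρ P ≤ ENNReal.ofReal δ → J P ≤ ε := by
  by_contra! h
  choose P hP hPt hPJ using fun k : ℕ => h (1 / ((k : ℝ) + 1)) (by positivity)
  have h1 : Tendsto (fun k => ρ (P k)) atTop (𝓝 0) := by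
    refine tendsto_of_tendsto_of_tendsto_of_le_of_le tendsto_const_nhds ?_ (fun _ => zero_le) hPt
    simpa using ENNReal.tendsto_ofReal tendsto_one_div_add_atTop_nhds_zero_nat
  have h2 := (hJ.small P hP h1).eventually_lt_const hε
  obtain ⟨k, hk⟩ := h2.exists
  exact (hPJ k).not_gt hk

/-- Split `b` at a level `e`. The lower part has operator norm and trace at most `e`, so the bound
by the norm of `L¹ ∩ L^∞` applies. The upper part is dominated in singular values by `c` times its
range projection, whose trace is at most `ρ b / e`. -/
theorem exists_nonneg_small (hJ : IsSymmetricNorm (M : Set (H →L[ℂ] H)) ρ J)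
    (hρ : IsFaithfulNormalSemifiniteTrace (M : Set (H →L[ℂ] H)) ρ) {c ε : ℝ} (hc : 0 < c)
    (hε : 0 < ε) : ∃ η : ℝ, 0 < η ∧ ∀ b ∈ M, 0 ≤ b → b ≤ c • (1 : H →L[ℂ] H) →
      ρ b ≤ ENNReal.ofReal η → J b ≤ ε := by
  obtain ⟨C₁, C, -, hC, hbd⟩ := hJ.bounds
  obtain ⟨δ, hδ, hproj⟩ := hJ.exists_projection_small (ε := ε / (2 * c)) (by positivity)
  set e := ε / (4 * C) with he
  have he0 : 0 < e := by positivity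
  -- The bound `e` controls the trace of the lower part, with `C (e + e) = ε / 2`. The bound `e * δ`
  -- makes the trace of the range projection of the upper part at most `δ`.
  refine ⟨min e (e * δ), by positivity, fun b hb hb0 hbc hbt => ?_⟩
  have hbt' : ρ b < ⊤ := hbt.trans_lt ENNReal.ofReal_lt_top
  have hgM := cut_mem hb e
  have hg0 := cut_nonneg e b
  have hm0 := sub_cut_nonneg hb0 he0.le
  have hmM : b - cut e b ∈ M := sub_mem hb hgM
  have hmt : ρ (b - cut e b) ≤ ρ b := hρ.mono hmM hb hm0 (sub_cut_le_self e)
  have hgt : ρ (cut e b) ≤ ρ b := hρ.mono hgM hb hg0 (cut_le hb0 he0.le)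
  have hmL := hρ.mem_boundedL1 hmM hm0 (hmt.trans_lt hbt')
  have hgL := hρ.mem_boundedL1 hgM hg0 (hgt.trans_lt hbt')
  have h1 : J (b - cut e b) ≤ ε / 2 := by
    refine (hbd _ hmL).2.trans ?_
    have h2 : ‖b - cut e b‖ ≤ e := norm_le_of_le_smul_one hm0 he0.le (sub_cut_le hb0 e)
    have h3 : norm1 ρ (b - cut e b) ≤ e := by
      rw [norm1, CFC.abs_of_nonneg _ hm0]
      refine ENNReal.toReal_le_of_le_ofReal he0.le (hmt.trans (hbt.trans ?_))
      exact ENNReal.ofReal_le_ofReal (min_le_left _ _)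
    calc C * (norm1 ρ (b - cut e b) + ‖b - cut e b‖) ≤ C * (e + e) := by gcongr
      _ = ε / 2 := by rw [he]; field_simp; norm_num
  set R := rangeProj (cut e b) with hR
  have hRp : IsStarProjection R := isStarProjection_rangeProj _
  have hRM : R ∈ M := rangeProj_mem hgM
  have hRt : ρ R ≤ ENNReal.ofReal δ := by
    have h4 := (hρ.mul_rangeProj_cut_le hb hb0 he0.le).trans
      (hbt.trans (ENNReal.ofReal_le_ofReal (min_le_right _ _)))
    rw [ENNReal.ofReal_mul he0.le] at h4
    exact (ENNReal.mul_le_mul_iff_right (by simpa using he0) ENNReal.ofReal_ne_top).1 h4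
  have hRf : R ∈ finProjections (M : Set (H →L[ℂ] H)) ρ :=
    ⟨⟨hRM, hRp⟩, hRt.trans_lt ENNReal.ofReal_lt_top⟩
  have hRL := hρ.mem_boundedL1 hRM hRp.nonneg hRf.2
  have hcRL : (c : ℂ) • R ∈ boundedL1 (M : Set (H →L[ℂ] H)) ρ := by
    rw [Complex.coe_smul]
    refine hρ.mem_boundedL1 (real_smul_mem c hRM) (smul_nonneg hc.le hRp.nonneg) ?_
    rw [hρ.map_real_smul hRM hRp.nonneg hc.le]
    exact ENNReal.mul_lt_top ENNReal.ofReal_lt_top hRf.2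
  have h5 : J (cut e b) ≤ ε / 2 := by
    have h6 : J (cut e b) ≤ J ((c : ℂ) • R) := by
      refine hJ.mono _ hgL _ hcRL fun t _ => genSingularValue_le hρ t fun P => ?_
      have h7 : ‖cut e b‖ ≤ c := norm_le_of_le_smul_one hg0 hc.le ((cut_le hb0 he0.le).trans hbc)
      -- Writing `cut e b = cut e b * R` gives `‖cut e b (1 - P)‖ ≤ c ‖R (1 - P)‖` for every `P`.
      rw [← mul_rangeProj (.of_nonneg hg0), ← hR, smul_mul_assoc, norm_smul, mul_assoc]
      refine (norm_mul_le _ _).trans ?_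
      rw [Complex.norm_of_nonneg hc.le]
      gcongr
    rw [hJ.smul _ _ hRL, Complex.norm_of_nonneg hc.le] at h6
    refine h6.trans ?_
    calc c * J R ≤ c * (ε / (2 * c)) := by gcongr; exact hproj R hRf hRt
      _ = ε / 2 := by field_simp
  calc J b = J ((b - cut e b) + cut e b) := by rw [sub_add_cancel]
    _ ≤ _ := hJ.add_le _ hmL _ hgL
    _ ≤ ε := by linarith

theorem exists_sub_small (hJ : IsSymmetricNorm (M : Set (H →L[ℂ] H)) ρ J)
    (hρ : IsFaithfulNormalSemifiniteTrace (M : Set (H →L[ℂ] H)) ρ) {c ε : ℝ} (hc : 0 < c)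
    (hε : 0 < ε) : ∃ η : ℝ, 0 < η ∧ ∀ a ∈ M, ∀ b ∈ M, 0 ≤ a → 0 ≤ b →
      a - b ≤ c • (1 : H →L[ℂ] H) → b - a ≤ c • (1 : H →L[ℂ] H) →
      ρ a ≤ ENNReal.ofReal η → ρ b ≤ ENNReal.ofReal η → J (a - b) ≤ ε := by
  obtain ⟨η, hη, h⟩ := hJ.exists_nonneg_small hρ hc (half_pos hε)
  refine ⟨η, hη, fun a ha b hb ha0 hb0 hab hba hat hbt => ?_⟩
  have hy : IsSelfAdjoint (a - b) := (IsSelfAdjoint.of_nonneg ha0).sub (.of_nonneg hb0)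
  have hM := sub_mem ha hb
  have h1 := (hρ.posPart_sub_le ha hb ha0 hb0).trans hat
  have h2 := (hρ.negPart_sub_le ha hb ha0 hb0).trans hbt
  have h3 := h _ (posPart_mem hM) (CFC.posPart_nonneg _) (posPart_le_smul_one hy hc.le hab) h1
  have h4 := h _ (negPart_mem hM) (CFC.negPart_nonneg _) (by
    rw [← CFC.posPart_neg]
    exact posPart_le_smul_one hy.neg hc.le (by rwa [neg_sub])) h2
  have hpL := hρ.mem_boundedL1 (posPart_mem hM) (CFC.posPart_nonneg _)
    (h1.trans_lt ENNReal.ofReal_lt_top)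
  have hnL := hρ.mem_boundedL1 (negPart_mem hM) (CFC.negPart_nonneg _)
    (h2.trans_lt ENNReal.ofReal_lt_top)
  have hnL' : -(a - b)⁻ ∈ boundedL1 (M : Set (H →L[ℂ] H)) ρ :=
    ⟨neg_mem hnL.1, by rw [CFC.abs_neg]; exact hnL.2⟩
  calc J (a - b) = J ((a - b)⁺ + -(a - b)⁻) := by
        rw [← sub_eq_add_neg, CFC.posPart_sub_negPart _ hy]
    _ ≤ J (a - b)⁺ + J (-(a - b)⁻) := hJ.add_le _ hpL _ hnL'
    _ = J (a - b)⁺ + J (a - b)⁻ := by rw [hJ.neg hnL]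
    _ ≤ ε := by linarith

end IsSymmetricNorm

end Norm

/-! ### Perturbation of competitors, and finite trace in place of finite rank -/

section Automorphisms

variable {M N : VonNeumannAlgebra H} {ρ : (H →L[ℂ] H) → ℝ≥0∞} {J : (H →L[ℂ] H) → ℝ}

theorem Aut.map_nonneg (β : Aut N) {x : N.toStarSubalgebra} (hx : 0 ≤ (x : H →L[ℂ] H)) :
    0 ≤ (β x : H →L[ℂ] H) := by
  let b : N.toStarSubalgebra := ⟨CFC.sqrt (x : H →L[ℂ] H), sqrt_mem x.2⟩
  have hb : star b * b = x := by
    ext1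
    change star (CFC.sqrt (x : H →L[ℂ] H)) * CFC.sqrt (x : H →L[ℂ] H) = x
    rw [(IsSelfAdjoint.of_nonneg (CFC.sqrt_nonneg (x : H →L[ℂ] H))).star_eq,
      CFC.sqrt_mul_sqrt_self (x : H →L[ℂ] H) hx]
  rw [← hb, map_mul, map_star]
  exact star_mul_self_nonneg (β b : H →L[ℂ] H)

theorem Aut.map_conj (β : Aut N) (c y : N.toStarSubalgebra) :
    (β (star c * y * c) : H →L[ℂ] H) = star (β c : H →L[ℂ] H) * β y * β c := by
  rw [map_mul, map_mul, map_star]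
  rfl

theorem Aut.map_le_map (β : Aut N) {x y : N.toStarSubalgebra}
    (h : (x : H →L[ℂ] H) ≤ (y : H →L[ℂ] H)) : (β x : H →L[ℂ] H) ≤ (β y : H →L[ℂ] H) := by
  have := β.map_nonneg (x := y - x) (sub_nonneg.2 h)
  rw [map_sub] at this
  exact sub_nonneg.1 this

theorem Aut.map_sub_le_smul_one (β : Aut N) {x y : N.toStarSubalgebra} {c : ℝ}
    (h : (x : H →L[ℂ] H) - (y : H →L[ℂ] H) ≤ c • (1 : H →L[ℂ] H)) :
    (β x : H →L[ℂ] H) - (β y : H →L[ℂ] H) ≤ c • (1 : H →L[ℂ] H) := by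
  have := β.map_le_map (x := x - y) (y := (c : ℂ) • 1) (by
    change (x : H →L[ℂ] H) - (y : H →L[ℂ] H) ≤ (c : ℂ) • (1 : H →L[ℂ] H)
    rwa [Complex.coe_smul])
  rw [map_sub, map_smul, map_one] at this
  change (β x : H →L[ℂ] H) - (β y : H →L[ℂ] H) ≤ (c : ℂ) • (1 : H →L[ℂ] H) at this
  rwa [Complex.coe_smul] at this

theorem boundedL1_add (hρ : IsFaithfulNormalSemifiniteTrace (M : Set (H →L[ℂ] H)) ρ)
    {a b c d : H →L[ℂ] H} (ha : a ∈ M) (hb : b ∈ M) (hc : c ∈ M) (hd : d ∈ M)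
    (ha0 : 0 ≤ a) (hb0 : 0 ≤ b) (hc0 : 0 ≤ c) (hd0 : 0 ≤ d)
    (hat : ρ a < ⊤) (hbt : ρ b < ⊤) (hct : ρ c < ⊤) (hdt : ρ d < ⊤) :
    (a - b) + (c - d) ∈ boundedL1 (M : Set (H →L[ℂ] H)) ρ := by
  rw [sub_add_sub_comm]
  refine hρ.sub_mem_boundedL1 (add_mem ha hc) (add_mem hb hd) (add_nonneg ha0 hc0)
    (add_nonneg hb0 hd0) ?_ ?_
  · rw [hρ.map_add _ ha _ hc ha0 hc0]
    exact ENNReal.add_lt_top.2 ⟨hat, hct⟩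
  · rw [hρ.map_add _ hb _ hd hb0 hd0]
    exact ENNReal.add_lt_top.2 ⟨hbt, hdt⟩

/-- The difference of `β B' - B'` and `β B - B` is `β (B' - B) - (B' - B)`, and `β` preserves both
the traces of `a, b` and the operator bounds. The constant `η` does not depend on the subalgebra or
on `β`, so it serves `N` and `M` alike. -/
theorem IsSymmetricNorm.exists_perturbation (hJ : IsSymmetricNorm (M : Set (H →L[ℂ] H)) ρ J)
    (hρ : IsFaithfulNormalSemifiniteTrace (M : Set (H →L[ℂ] H)) ρ) {c ε : ℝ} (hc : 0 < c)
    (hε : 0 < ε) : ∃ η : ℝ, 0 < η ∧ ∀ N : VonNeumannAlgebra H, N ≤ M → ∀ β : Aut N,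
      PreservesTrace ρ β → ∀ B B' a b : N.toStarSubalgebra,
      0 ≤ (B : H →L[ℂ] H) → 0 ≤ (B' : H →L[ℂ] H) → 0 ≤ (a : H →L[ℂ] H) → 0 ≤ (b : H →L[ℂ] H) →
      ρ B < ⊤ → ρ B' < ⊤ → B' - B = a - b →
      (B' : H →L[ℂ] H) - B ≤ c • (1 : H →L[ℂ] H) → (B : H →L[ℂ] H) - B' ≤ c • (1 : H →L[ℂ] H) →
      ρ a ≤ ENNReal.ofReal η → ρ b ≤ ENNReal.ofReal η →
      J (β B' - B') ≤ J (β B - B) + ε := by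
  obtain ⟨η, hη, h⟩ := hJ.exists_sub_small hρ hc (half_pos hε)
  refine ⟨η, hη, fun N hNM β hβ B B' a b hB hB' ha hb hBt hB't heq h1 h2 hat hbt => ?_⟩
  have e1 : (B' : H →L[ℂ] H) - B = a - b := congrArg Subtype.val heq
  have e2 : (B : H →L[ℂ] H) - B' = b - a := by rw [← neg_sub, e1, neg_sub]
  have e3 : (β B' : H →L[ℂ] H) - β B = β a - β b := by
    have := congrArg (fun z => (β z : H →L[ℂ] H)) heq
    simp only [map_sub] at this
    exact this
  have e4 : (β B : H →L[ℂ] H) - β B' = β b - β a := by rw [← neg_sub, e3, neg_sub]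
  have m : ∀ x : N.toStarSubalgebra, (x : H →L[ℂ] H) ∈ M := fun x => hNM x.2
  have k1 : J ((β B' : H →L[ℂ] H) - β B) ≤ ε / 2 := by
    rw [e3]
    exact h _ (m _) _ (m _) (β.map_nonneg ha) (β.map_nonneg hb)
      (by rw [← e3]; exact β.map_sub_le_smul_one h1)
      (by rw [← e4]; exact β.map_sub_le_smul_one h2)
      (by rwa [hβ a ha]) (by rwa [hβ b hb])
  have k2 : J ((B : H →L[ℂ] H) - B') ≤ ε / 2 := by
    rw [e2]
    exact h _ (m _) _ (m _) hb ha (by rwa [← e2]) (by rwa [← e1]) hbt hat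
  have t1 : ρ (β B) < ⊤ := by rwa [hβ B hB]
  have t2 : ρ (β B') < ⊤ := by rwa [hβ B' hB']
  have l1 : (β B : H →L[ℂ] H) - B ∈ boundedL1 (M : Set (H →L[ℂ] H)) ρ :=
    hρ.sub_mem_boundedL1 (m _) (m _) (β.map_nonneg hB) hB t1 hBt
  have l2 : (β B' : H →L[ℂ] H) - β B ∈ boundedL1 (M : Set (H →L[ℂ] H)) ρ :=
    hρ.sub_mem_boundedL1 (m _) (m _) (β.map_nonneg hB') (β.map_nonneg hB) t2 t1
  have l3 : (B : H →L[ℂ] H) - B' ∈ boundedL1 (M : Set (H →L[ℂ] H)) ρ :=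
    hρ.sub_mem_boundedL1 (m _) (m _) hB hB' hBt hB't
  have l4 : ((β B' : H →L[ℂ] H) - β B) + (B - B') ∈ boundedL1 (M : Set (H →L[ℂ] H)) ρ :=
    boundedL1_add hρ (m _) (m _) (m _) (m _) (β.map_nonneg hB') (β.map_nonneg hB) hB hB' t2 t1
      hBt hB't
  calc J (β B' - B')
      = J (((β B : H →L[ℂ] H) - B) + (((β B' : H →L[ℂ] H) - β B) + (B - B'))) := by
        congr 1; abel
    _ ≤ J ((β B : H →L[ℂ] H) - B) + J (((β B' : H →L[ℂ] H) - β B) + (B - B')) :=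
        hJ.add_le _ l1 _ l4
    _ ≤ J ((β B : H →L[ℂ] H) - B) + (J ((β B' : H →L[ℂ] H) - β B) + J ((B : H →L[ℂ] H) - B')) := by
        gcongr
        exact hJ.add_le _ l2 _ l3
    _ ≤ _ := by linarith

theorem iSup_ofReal_le_add {n : ℕ} {f g : Fin n → ℝ} {ε : ℝ} (h : ∀ j, f j ≤ g j + ε) :
    ⨆ j, ENNReal.ofReal (f j) ≤ (⨆ j, ENNReal.ofReal (g j)) + ENNReal.ofReal ε :=
  iSup_le fun j => (ENNReal.ofReal_le_ofReal (h j)).trans <| ENNReal.ofReal_add_le.trans <|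
    add_le_add_left (le_iSup (fun j => ENNReal.ofReal (g j)) j) _

/-- The element `B' = (1 - e)⁻¹ (B - e)⁺` has finite rank by Chebyshev, is still a contraction, and
keeps the conditions on `P` and `Q`. As `e` tends to `0` it approaches `B` in trace. -/
theorem finModulus_le_iSup (hJ : IsSymmetricNorm (M : Set (H →L[ℂ] H)) ρ J)
    (hρ : IsFaithfulNormalSemifiniteTrace (M : Set (H →L[ℂ] H)) ρ) (hNM : N ≤ M) {n : ℕ}
    (β : Fin n → Aut N) (hβ : ∀ j, PreservesTrace ρ (β j)) (B : N.toStarSubalgebra)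
    (hB0 : 0 ≤ (B : H →L[ℂ] H)) (hB1 : (B : H →L[ℂ] H) ≤ 1) (hBt : ρ B < ⊤) {P Q : H →L[ℂ] H}
    (hP : IsStarProjection P) (hBP : (B : H →L[ℂ] H) * P = P) (hBQ : (B : H →L[ℂ] H) * Q = 0) :
    finModulus N ρ J β P Q ≤ ⨆ j, ENNReal.ofReal (J ((β j B : H →L[ℂ] H) - B)) := by
  refine ENNReal.le_of_forall_pos_le_add fun ε hε _ => ?_
  obtain ⟨η, hη, hpert⟩ := hJ.exists_perturbation hρ one_pos (NNReal.coe_pos.2 hε)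
  set r := (ρ B).toReal
  have hr : ρ B = ENNReal.ofReal r := (ENNReal.ofReal_toReal hBt.ne).symm
  have hr0 : 0 ≤ r := ENNReal.toReal_nonneg
  have hBM : (B : H →L[ℂ] H) ∈ M := hNM B.2
  have hBN : (B : H →L[ℂ] H) ∈ N := B.2
  -- The bound `1 / 2` gives `(1 - e)⁻¹ ≤ 2`. The other bound then gives `e (1 - e)⁻¹ ρ(B) ≤ η`,
  -- where `r + 1` avoids division by zero.
  obtain ⟨e, ⟨he0, he⟩, hcut⟩ := hρ.exists_sub_cut_le hBM hB0 hBt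
    (η := ENNReal.ofReal η) (by simpa using hη) (δ := min (1 / 2) (η / (2 * (r + 1))))
    (by positivity)
  have he1 : e < 1 / 2 := he.trans_le (min_le_left _ _)
  have he2 : e < η / (2 * (r + 1)) := he.trans_le (min_le_right _ _)
  have hk0 : 0 ≤ (1 - e)⁻¹ := inv_nonneg.2 (by linarith)
  have hk2 : (1 - e)⁻¹ ≤ 2 := by
    rw [inv_le_comm₀ (by linarith) two_pos]; linarith
  have hkm : (1 - e)⁻¹ * (1 - e) = 1 := inv_mul_cancel₀ (by linarith)
  set g := cut e (B : H →L[ℂ] H) with hg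
  have hgN : g ∈ N := cut_mem hBN e
  have hg0 : 0 ≤ g := cut_nonneg e _
  have hgt : ρ g ≤ ρ B := hρ.mono (hNM hgN) hBM hg0 (cut_le hB0 he0.le)
  have hRp : IsStarProjection (rangeProj g) := isStarProjection_rangeProj g
  have hgR : g ≤ (1 - e) • rangeProj g :=
    cut_le_smul_rangeProj hB0 (c := 1) (by rwa [one_smul])
  -- Since `(1 - e)⁻¹ = e (1 - e)⁻¹ + 1`, the change `B' - B` is the rescaling gain `a` minus the
  -- truncation loss `b`.
  let B' : N.toStarSubalgebra := ⟨(1 - e)⁻¹ • g, real_smul_mem _ hgN⟩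
  let a : N.toStarSubalgebra := ⟨(e * (1 - e)⁻¹) • g, real_smul_mem _ hgN⟩
  let b : N.toStarSubalgebra := ⟨(B : H →L[ℂ] H) - g, sub_mem hBN hgN⟩
  have hB'0 : 0 ≤ (1 - e)⁻¹ • g := smul_nonneg hk0 hg0
  have hB'1 : (1 - e)⁻¹ • g ≤ 1 := by
    refine (smul_le_smul_of_nonneg_left hgR hk0).trans ?_
    rw [smul_smul, hkm, one_smul]
    exact hRp.le_one
  have hB't : ρ ((1 - e)⁻¹ • g) < ⊤ := by
    rw [hρ.map_real_smul (hNM hgN) hg0 hk0]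
    exact ENNReal.mul_lt_top ENNReal.ofReal_lt_top (hgt.trans_lt hBt)
  have hfeas : ((B' : H →L[ℂ] H) ∈ finRankContractions (N : Set (H →L[ℂ] H)) ρ ∧
      (B' : H →L[ℂ] H) * P = P ∧ (B' : H →L[ℂ] H) * Q = 0) := by
    refine ⟨⟨B'.2, hB'0, hB'1, rangeProj g, ⟨⟨rangeProj_mem hgN, hRp⟩,
      hρ.rangeProj_cut_lt_top hBM hB0 hBt he0⟩, ?_⟩, ?_, ?_⟩
    · change (1 - e)⁻¹ • g * rangeProj g = (1 - e)⁻¹ • g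
      rw [smul_mul_assoc, mul_rangeProj (.of_nonneg hg0)]
    · change (1 - e)⁻¹ • g * P = P
      rw [smul_mul_assoc, cut_mul_of_mul_eq_self hB0 hP hBP (by linarith), smul_smul, hkm, one_smul]
    · change (1 - e)⁻¹ • g * Q = 0
      rw [smul_mul_assoc, cut_mul_eq_zero hB0 hBQ he0.le, smul_zero]
  refine (iInf₂_le B' hfeas).trans ?_
  rw [← ENNReal.ofReal_coe_nnreal]
  refine iSup_ofReal_le_add fun j => ?_
  refine hpert N hNM (β j) (hβ j) B B' a b hB0 hB'0 (smul_nonneg (by positivity) hg0)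
    (sub_cut_nonneg hB0 he0.le) hBt hB't ?_ ?_ ?_ ?_ hcut
  · ext1
    change (1 - e)⁻¹ • g - B = (e * (1 - e)⁻¹) • g - (B - g)
    have hk : (1 - e)⁻¹ = e * (1 - e)⁻¹ + 1 := by linear_combination hkm
    nth_rw 1 [hk]
    rw [add_smul, one_smul]
    abel
  · rw [one_smul]
    exact (sub_le_self _ hB0).trans hB'1
  · rw [one_smul]
    exact (sub_le_self _ hB'0).trans hB1
  · change ρ ((e * (1 - e)⁻¹) • g) ≤ _
    rw [hρ.map_real_smul (hNM hgN) hg0 (by positivity)]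
    calc ENNReal.ofReal (e * (1 - e)⁻¹) * ρ g
        ≤ ENNReal.ofReal (e * (1 - e)⁻¹) * ENNReal.ofReal r := by rw [← hr]; gcongr
      _ = ENNReal.ofReal (e * (1 - e)⁻¹ * r) := (ENNReal.ofReal_mul (by positivity)).symm
      _ ≤ ENNReal.ofReal η := by
        refine ENNReal.ofReal_le_ofReal ?_
        calc e * (1 - e)⁻¹ * r ≤ e * 2 * (r + 1) := by gcongr; linarith
          _ ≤ η := by
            rw [lt_div_iff₀ (by positivity)] at he2
            linarith

end Automorphisms

/-! ### The conditional expectation commutes with the automorphisms -/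

section Expectation

variable {M N : VonNeumannAlgebra H} {ρ : (H →L[ℂ] H) → ℝ≥0∞}

/-- Testing with the range projection `s` of `(u - v)⁺` gives `ρ (s v s) + ρ (u - v)⁺ = ρ (s v s)`.
Finiteness of `ρ v` permits cancellation, and faithfulness gives `(u - v)⁺ = 0`. -/
theorem le_of_trace_conj_eq (hρ : IsFaithfulNormalSemifiniteTrace (M : Set (H →L[ℂ] H)) ρ)
    (hNM : N ≤ M) {u v : H →L[ℂ] H} (hu : u ∈ N) (hv : v ∈ N) (hu0 : 0 ≤ u) (hv0 : 0 ≤ v)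
    (hvt : ρ v < ⊤) (h : ∀ b ∈ N, ρ (star b * u * b) = ρ (star b * v * b)) : u ≤ v := by
  have hy : IsSelfAdjoint (u - v) := (IsSelfAdjoint.of_nonneg hu0).sub (.of_nonneg hv0)
  set s := rangeProj (u - v)⁺ with hs
  have hsp : IsStarProjection s := isStarProjection_rangeProj _
  have hsN : s ∈ N := rangeProj_mem (posPart_mem (sub_mem hu hv))
  have h1 : s * u * s = s * v * s + (u - v)⁺ := by
    rw [← rangeProj_posPart_mul_mul hy, ← hs, mul_sub, sub_mul, add_sub_cancel]
  have h2 := h s hsN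
  have hvs : s * v * s ∈ M := hNM (mul_mem (mul_mem hsN hv) hsN)
  have h3 : ρ (s * v * s) < ⊤ := (hρ.conj_proj_le (hNM hv) (hNM hsN) hv0 hsp).trans_lt hvt
  have hp : (u - v)⁺ ∈ M := hNM (posPart_mem (sub_mem hu hv))
  rw [hsp.isSelfAdjoint.star_eq, h1, hρ.map_add _ hvs _ hp (conj_nonneg hsp.isSelfAdjoint hv0)
    (CFC.posPart_nonneg _)] at h2
  have h4 : ρ (u - v)⁺ = 0 := by
    have : ρ (s * v * s) + ρ (u - v)⁺ = ρ (s * v * s) + 0 := by rw [h2, add_zero]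
    exact (ENNReal.add_right_inj h3.ne).1 this
  have h5 := hρ.faithful _ hp (CFC.posPart_nonneg _) h4
  exact sub_nonpos.1 ((CFC.le_posPart hy).trans_eq h5)

theorem coe_incl (hNM : N ≤ M) (x : N.toStarSubalgebra) :
    (incl hNM x : H →L[ℂ] H) = x := rfl

/-- Both sides lie in `N` and satisfy `ρ (b* · b) = ρ (b* α(x) b)` for all `b ∈ N`; such an element
is unique. For the right side, `α(N) = N` allows writing `b = α(c)` with `c ∈ N`. -/
theorem IsConditionalExpectation.map_aut
    (hρ : IsFaithfulNormalSemifiniteTrace (M : Set (H →L[ℂ] H)) ρ) {hNM : N ≤ M}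
    {E : M.toStarSubalgebra →ₗ[ℂ] N.toStarSubalgebra} (hE : IsConditionalExpectation hNM ρ E)
    {α : Aut M} (hα : PreservesTrace ρ α) (hαN : MapsOnto hNM α) {x : M.toStarSubalgebra}
    (hx : 0 ≤ (x : H →L[ℂ] H)) (hxt : ρ x < ⊤) :
    (E (α x) : H →L[ℂ] H) = α (incl hNM (E x)) := by
  have hαx : 0 ≤ (α x : H →L[ℂ] H) := α.map_nonneg hx
  have hEx : 0 ≤ (E x : H →L[ℂ] H) := hE.nonneg x hx
  have hu0 : 0 ≤ (E (α x) : H →L[ℂ] H) := hE.nonneg _ hαx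
  have hv0 : 0 ≤ (α (incl hNM (E x)) : H →L[ℂ] H) := α.map_nonneg hEx
  have hvN : (α (incl hNM (E x)) : H →L[ℂ] H) ∈ N := hαN.subset ⟨_, rfl⟩
  have hut : ρ (E (α x)) < ⊤ := by rwa [hE.trace_eq _ hαx, hα x hx]
  have hvt : ρ (α (incl hNM (E x))) < ⊤ := by
    rw [hα _ hEx, coe_incl, hE.trace_eq x hx]; exact hxt
  have key : ∀ (y : M.toStarSubalgebra) (c : N.toStarSubalgebra), 0 ≤ (y : H →L[ℂ] H) →
      ρ (star (c : H →L[ℂ] H) * E y * c) = ρ (star (c : H →L[ℂ] H) * y * c) := by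
    intro y c hy
    have h1 := hE.trace_eq (incl hNM (star c) * y * incl hNM c)
      (star_left_conjugate_nonneg hy (c : H →L[ℂ] H))
    rw [hE.bimodule] at h1
    exact h1
  have h : ∀ b ∈ N, ρ (star b * (E (α x) : H →L[ℂ] H) * b) =
      ρ (star b * (α (incl hNM (E x)) : H →L[ℂ] H) * b) := by
    intro b hb
    obtain ⟨c, hc⟩ := hαN.symm.subset hb
    replace hc : (α (incl hNM c) : H →L[ℂ] H) = b := hc
    have hmul : ∀ y : M.toStarSubalgebra, 0 ≤ (y : H →L[ℂ] H) →
        ρ (star b * (α y : H →L[ℂ] H) * b) = ρ (star (c : H →L[ℂ] H) * y * c) := by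
      intro y hy
      rw [← hc, ← Aut.map_conj]
      exact hα (star (incl hNM c) * y * incl hNM c)
        (star_left_conjugate_nonneg hy (c : H →L[ℂ] H))
    rw [hmul _ hEx, coe_incl, key x c hx, ← hmul x hx]
    exact key (α x) ⟨b, hb⟩ hαx
  exact le_antisymm (le_of_trace_conj_eq hρ hNM (E (α x)).2 hvN hu0 hv0 hvt h)
    (le_of_trace_conj_eq hρ hNM hvN (E (α x)).2 hv0 hu0 hut fun b hb => (h b hb).symm)

end Expectation

/-! ### Approximation by finite projections of the subalgebra -/

section Projections

variable {M N : VonNeumannAlgebra H} {ρ : (H →L[ℂ] H) → ℝ≥0∞}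

theorem le_of_mul_eq {s p : H →L[ℂ] H} (hs : IsStarProjection s) (hp : IsStarProjection p)
    (h : p * s = s) : s ≤ p := by
  have h1 : s * p = s := by
    have := congrArg star h
    rwa [star_mul, hs.isSelfAdjoint.star_eq, hp.isSelfAdjoint.star_eq] at this
  have := conj_le_conj hp.isSelfAdjoint hs.le_one
  rwa [mul_one, hp.isIdempotentElem.eq, h, h1] at this

theorem mul_eq_of_le {a p : H →L[ℂ] H} (hp : IsStarProjection p) (ha : 0 ≤ a) (h : a ≤ p) :
    p * a = a := (hp.mul_right_and_mul_left_of_nonneg_of_le ha h).2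

theorem mul_eq_of_le' {a p : H →L[ℂ] H} (hp : IsStarProjection p) (ha : 0 ≤ a) (h : a ≤ p) :
    a * p = a := (hp.mul_right_and_mul_left_of_nonneg_of_le ha h).1

theorem exists_rangeProj_cut_ne_zero {y : H →L[ℂ] H} (hy0 : 0 ≤ y) (hy : y ≠ 0) :
    ∃ ε : ℝ, 0 < ε ∧ rangeProj (cut ε y) ≠ 0 := by
  by_contra! hcon
  refine hy (le_antisymm (le_of_forall_sub_smul_one_le one_pos fun ε hε => ?_) hy0)
  refine (CFC.le_posPart (isSelfAdjoint_sub_smul_one hy0 ε)).trans_eq ?_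
  have := rangeProj_mul (cut ε y)
  rw [hcon ε hε.1, zero_mul] at this
  exact this.symm

/-- Semifiniteness supplies a positive `y ≤ x` of finite trace. A nonzero spectral projection of `y`
above a positive level has finite trace by Chebyshev and lies below `x`. -/
theorem exists_finProjection_le (hρ : IsFaithfulNormalSemifiniteTrace (M : Set (H →L[ℂ] H)) ρ)
    (hNM : N ≤ M) (hN : IsSemifinite (N : Set (H →L[ℂ] H)) ρ) {x : H →L[ℂ] H} (hx : x ∈ N)
    (hxp : IsStarProjection x) (hx0 : x ≠ 0) :
    ∃ s ∈ finProjections (N : Set (H →L[ℂ] H)) ρ, s ≠ 0 ∧ s ≤ x := by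
  obtain ⟨y, hy, hy0, hyx, hyne, hyt⟩ := hN x hx hxp.nonneg hx0
  obtain ⟨ε, hε, hs⟩ := exists_rangeProj_cut_ne_zero hy0 hyne
  refine ⟨rangeProj (cut ε y), ⟨⟨rangeProj_mem (cut_mem hy ε), isStarProjection_rangeProj _⟩,
    hρ.rangeProj_cut_lt_top (hNM hy) hy0 hyt hε⟩, hs, ?_⟩
  refine le_of_mul_eq (isStarProjection_rangeProj _) hxp ?_
  have h1 : y * (1 - x) = 0 := by rw [mul_sub, mul_one, mul_eq_of_le' hxp hy0 hyx, sub_self]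
  have h2 := congrArg star (cut_mul_eq_zero hy0 h1 hε.le)
  rw [star_mul, hxp.one_sub.isSelfAdjoint.star_eq,
    (IsSelfAdjoint.of_nonneg (cut_nonneg ε y)).star_eq, star_zero] at h2
  have h3 := mul_rangeProj_eq_zero h2
  rw [sub_mul, one_mul, sub_eq_zero] at h3
  exact h3.symm

/-- Pairwise orthogonal families of nonzero projections of finite trace below `P`. -/
def orthogonalFamilies (N : VonNeumannAlgebra H) (ρ : (H →L[ℂ] H) → ℝ≥0∞) (P : H →L[ℂ] H) :
    Set (Set (H →L[ℂ] H)) :=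
  {S | (∀ e ∈ S, e ∈ finProjections (N : Set (H →L[ℂ] H)) ρ ∧ e ≤ P ∧ e ≠ 0) ∧
    S.Pairwise fun e f => e * f = 0}

theorem exists_maximal_orthogonalFamily (N : VonNeumannAlgebra H) (ρ : (H →L[ℂ] H) → ℝ≥0∞)
    (P : H →L[ℂ] H) : ∃ S, Maximal (· ∈ orthogonalFamilies N ρ P) S := by
  refine zorn_subset _ fun c hc hchain => ⟨⋃₀ c, ⟨?_, ?_⟩, fun s hs => Set.subset_sUnion_of_mem hs⟩
  · rintro e ⟨s, hs, he⟩
    exact (hc hs).1 e he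
  · exact (Set.pairwise_sUnion hchain.directedOn).2 fun s hs => (hc hs).2

/-- The sum of a finite subfamily. -/
noncomputable def familySum {S : Set (H →L[ℂ] H)} (t : Finset S) : H →L[ℂ] H := ∑ e ∈ t, (e : H →L[ℂ] H)

theorem familySum_spec (hρ : IsFaithfulNormalSemifiniteTrace (M : Set (H →L[ℂ] H)) ρ)
    (hNM : N ≤ M) {P : H →L[ℂ] H} (hP : IsStarProjection P) {S : Set (H →L[ℂ] H)}
    (hS : S ∈ orthogonalFamilies N ρ P) (t : Finset S) :
    familySum t ∈ finProjections (N : Set (H →L[ℂ] H)) ρ ∧ familySum t ≤ P := by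
  classical
  suffices h : familySum t ∈ finProjections (N : Set (H →L[ℂ] H)) ρ ∧
      P * familySum t = familySum t from ⟨h.1, le_of_mul_eq h.1.1.2 hP h.2⟩
  induction t using Finset.induction_on with
  | empty =>
    simp only [familySum, Finset.sum_empty, mul_zero, and_true]
    exact ⟨⟨zero_mem N, .zero _⟩, by simp [hρ.map_zero]⟩
  | insert e t het ih =>
    have hsum : familySum (insert e t) = (e : H →L[ℂ] H) + familySum t :=
      Finset.sum_insert het
    obtain ⟨⟨⟨heN, hep⟩, het'⟩, heP, -⟩ := hS.1 e e.2
    have horth : (e : H →L[ℂ] H) * familySum t = 0 := by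
      rw [familySum, Finset.mul_sum]
      refine Finset.sum_eq_zero fun f hf => hS.2 e.2 f.2 fun hef => ?_
      exact het (Subtype.ext hef ▸ hf)
    rw [hsum]
    refine ⟨⟨⟨add_mem heN ih.1.1.1, hep.add ih.1.1.2 horth⟩, ?_⟩, ?_⟩
    · rw [hρ.map_add _ (hNM heN) _ (hNM ih.1.1.1) hep.nonneg ih.1.1.2.nonneg]
      exact ENNReal.add_lt_top.2 ⟨het', ih.1.2⟩
    · rw [mul_add, ih.2, mul_eq_of_le hP hep.nonneg heP]

theorem familySum_mono {P : H →L[ℂ] H} {S : Set (H →L[ℂ] H)}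
    (hS : S ∈ orthogonalFamilies N ρ P) : Monotone (familySum (S := S)) := fun _ _ h =>
  Finset.sum_le_sum_of_subset_of_nonneg h fun e _ _ => (hS.1 e e.2).1.1.2.nonneg

/-- The finite sums converge strongly to a projection `R ≤ P` of `N`. If `R ≠ P`, a nonzero finite
projection below `P - R` is orthogonal to the whole family, against maximality. -/
theorem tendsto_familySum (hρ : IsFaithfulNormalSemifiniteTrace (M : Set (H →L[ℂ] H)) ρ)
    (hNM : N ≤ M) (hN : IsSemifinite (N : Set (H →L[ℂ] H)) ρ) {P : H →L[ℂ] H} (hPN : P ∈ N)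
    (hP : IsStarProjection P) {S : Set (H →L[ℂ] H)}
    (hS : Maximal (· ∈ orthogonalFamilies N ρ P) S) (v : H) :
    Tendsto (fun t : Finset S => familySum t v) atTop (𝓝 (P v)) := by
  have hF := familySum_spec hρ hNM hP hS.prop
  have hpr : ∀ t : Finset S, ∃ _ : (familySum t).range.HasOrthogonalProjection,
      familySum t = (familySum t).range.starProjection := fun t =>
    isStarProjection_iff_eq_starProjection_range.1 (hF t).1.1.2
  have : ∀ t : Finset S, (familySum t).range.HasOrthogonalProjection := fun t => (hpr t).1
  set U : Finset S → Submodule ℂ H := fun t => (familySum t).range with hU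
  have hmono : Monotone U := fun s t h => by
    have h1 := mul_eq_of_le (hF t).1.1.2 (hF s).1.1.2.nonneg (familySum_mono hS.prop h)
    rintro _ ⟨w, rfl⟩
    exact ⟨familySum s w, DFunLike.congr_fun h1 w⟩
  have hlim := Submodule.starProjection_tendsto_closure_iSup U hmono v
  set R := (⨆ t, U t).topologicalClosure.starProjection with hR
  have hRp : IsStarProjection R := isStarProjection_starProjection
  have hle : ∀ t, U t ≤ (⨆ t, U t).topologicalClosure := fun t =>
    (le_iSup U t).trans (Submodule.le_topologicalClosure _)
  have hRF : ∀ t : Finset S, R * familySum t = familySum t := fun t => by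
    ext w
    exact Submodule.starProjection_eq_self_iff.2 (hle t ⟨w, rfl⟩)
  have hRN : R ∈ N := by
    refine starProjection_mem fun T hT w hw => ?_
    have h2 : (⨆ t, U t).topologicalClosure ≤
        (⨆ t, U t).topologicalClosure.comap (T : H →ₗ[ℂ] H) := by
      refine Submodule.topologicalClosure_minimal _ (iSup_le fun t => ?_)
        ((Submodule.isClosed_topologicalClosure _).preimage T.continuous)
      rintro _ ⟨w, rfl⟩
      refine hle t ⟨T w, ?_⟩
      exact (DFunLike.congr_fun (commute_of_mem_commutant (hF t).1.1.1 hT).eq w).symm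
    exact h2 hw
  have hPR : P * R = R := by
    ext w
    have h3 : (⨆ t, U t).topologicalClosure ≤ (1 - P).ker := by
      refine Submodule.topologicalClosure_minimal _ (iSup_le fun t => ?_) (1 - P).isClosed_ker
      rintro _ ⟨w, rfl⟩
      have h4 : (1 - P) * familySum t = 0 := by
        rw [sub_mul, one_mul, mul_eq_of_le hP (hF t).1.1.2.nonneg (hF t).2, sub_self]
      exact DFunLike.congr_fun h4 w
    have h5 : (1 - P) (R w) = 0 := h3 (Submodule.starProjection_apply_mem _ w)
    exact (sub_eq_zero.1 h5).symm
  have hRP : R * P = R := by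
    have := congrArg star hPR
    rwa [star_mul, hRp.isSelfAdjoint.star_eq, hP.isSelfAdjoint.star_eq] at this
  have hPR' : R = P := by
    by_contra hne
    have hxp : IsStarProjection (P - R) := hRp.sub_of_mul_eq_left hP hRP
    obtain ⟨s, hs, hs0, hsx⟩ := exists_finProjection_le hρ hNM hN (sub_mem hPN hRN) hxp
      (sub_ne_zero.2 (Ne.symm hne))
    have h6 : s * R = 0 := by
      rw [← mul_eq_of_le' hxp hs.1.2.nonneg hsx, mul_assoc, sub_mul, hPR,
        hRp.isIdempotentElem.eq, sub_self, mul_zero]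
    have hRe : ∀ e ∈ S, R * e = e := fun e he => by
      simpa [familySum] using hRF {⟨e, he⟩}
    have hse : ∀ e ∈ S, s * e = 0 := fun e he => by
      rw [← hRe e he, ← mul_assoc, h6, zero_mul]
    have hes : ∀ e ∈ S, e * s = 0 := fun e he => by
      have := congrArg star (hse e he)
      rwa [star_mul, hs.1.2.isSelfAdjoint.star_eq,
        (hS.prop.1 e he).1.1.2.isSelfAdjoint.star_eq, star_zero] at this
    have hins : insert s S ∈ orthogonalFamilies N ρ P := by
      refine ⟨?_, ?_⟩
      · rintro e (rfl | he)
        · exact ⟨hs, hsx.trans (sub_le_self _ hRp.nonneg), hs0⟩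
        · exact hS.prop.1 e he
      · exact hS.prop.2.insert fun e he _ => ⟨hse e he, hes e he⟩
    have hsS : s ∈ S := hS.le_of_ge hins (Set.subset_insert s S) (Set.mem_insert s S)
    have := hse s hsS
    rw [hs.1.2.isIdempotentElem.eq] at this
    exact hs0 this
  rw [hPR'] at hlim
  refine hlim.congr fun t => ?_
  exact DFunLike.congr_fun (hpr t).2.symm v

/-- The finite sums `F` increase strongly to `P`, so the compressions `p F p` increase to `p P p =
p`. Compressing brings the limit to finite trace, where normality yields an approximation. -/
theorem exists_finProjection_trace_conj_sub_le
    (hρ : IsFaithfulNormalSemifiniteTrace (M : Set (H →L[ℂ] H)) ρ) (hNM : N ≤ M)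
    (hN : IsSemifinite (N : Set (H →L[ℂ] H)) ρ) {P p : H →L[ℂ] H} (hPN : P ∈ N)
    (hP : IsStarProjection P) (hp : p ∈ finProjections (M : Set (H →L[ℂ] H)) ρ) (hpP : p ≤ P)
    {η : ℝ≥0∞} (hη : η ≠ 0) :
    ∃ P₁ ∈ finProjections (N : Set (H →L[ℂ] H)) ρ, P₁ ≤ P ∧ ρ (p * (1 - P₁) * p) ≤ η := by
  obtain ⟨S, hS⟩ := exists_maximal_orthogonalFamily N ρ P
  have hF := familySum_spec hρ hNM hP hS.prop
  have hlim := tendsto_familySum hρ hNM hN hPN hP hS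
  have hpsa := hp.1.2.isSelfAdjoint
  have hpPp : p * P * p = p := by
    rw [mul_eq_of_le' hP hp.1.2.nonneg hpP, hp.1.2.isIdempotentElem.eq]
  have key : ∃ d ∈ Set.range (fun t : Finset S => p * familySum t * p), ρ (p - d) ≤ η := by
    refine hρ.exists_sub_le_of_isLUB ?_ ?_ (Set.range_nonempty _) ?_ hp.1.1 ⟨?_, ?_⟩ hp.2 hη
    · rintro _ ⟨t, rfl⟩
      exact mul_mem (mul_mem hp.1.1 (hNM (hF t).1.1.1)) hp.1.1
    · rintro _ ⟨t, rfl⟩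
      exact conj_nonneg hpsa (hF t).1.1.2.nonneg
    · refine directedOn_range.2 (Monotone.directed_le fun s t h => ?_)
      exact conj_le_conj hpsa (familySum_mono hS.prop h)
    · rintro _ ⟨t, rfl⟩
      exact (conj_le_conj hpsa (hF t).2).trans_eq hpPp
    · intro T hT
      have hT0 : ∀ t : Finset S, (T - p * familySum t * p).IsPositive := fun t =>
        hT ⟨t, rfl⟩
      -- The empty subfamily has sum `0`, so an upper bound `T` is positive. The inequality `p ≤ T`
      -- is then the limit of inequalities between quadratic forms.
      have hTsa : IsSelfAdjoint T := by
        have h1 := (hT0 ∅).isSelfAdjoint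
        simpa [familySum] using h1
      change (T - p).IsPositive
      rw [ContinuousLinearMap.isPositive_def']
      refine ⟨hTsa.sub hpsa, fun v => ?_⟩
      have h2 : Tendsto (fun t : Finset S => (T - p * familySum t * p).reApplyInnerSelf v) atTop
          (𝓝 ((T - p).reApplyInnerSelf v)) := by
        have h3 : Tendsto (fun t : Finset S => T v - p (familySum t (p v))) atTop
            (𝓝 (T v - p (P (p v)))) :=
          tendsto_const_nhds.sub ((p.continuous.tendsto _).comp (hlim (p v)))
        have h4 : p (P (p v)) = p v := DFunLike.congr_fun hpPp v
        rw [h4] at h3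
        exact (RCLike.continuous_re.tendsto _).comp (h3.inner tendsto_const_nhds)
      exact ge_of_tendsto h2 (.of_forall fun t => (ContinuousLinearMap.isPositive_def'.1 (hT0 t)).2 v)
  obtain ⟨_, ⟨t, rfl⟩, ht⟩ := key
  refine ⟨familySum t, (hF t).1, (hF t).2, ?_⟩
  rwa [mul_sub, mul_one, sub_mul, hp.1.2.isIdempotentElem.eq]

end Projections

/-! ### Correcting a competitor, and the two inequalities -/

section Comparison

variable {M N : VonNeumannAlgebra H} {ρ : (H →L[ℂ] H) → ℝ≥0∞} {J : (H →L[ℂ] H) → ℝ}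

theorem star_mul_self_add_le (x y : H →L[ℂ] H) :
    star (x + y) * (x + y) ≤ (2 : ℝ) • (star x * x + star y * y) := by
  have h := star_mul_self_nonneg (x - y)
  have h2 : (2 : ℝ) • (star x * x + star y * y) - star (x + y) * (x + y) =
      star (x - y) * (x - y) := by
    rw [two_smul, star_add, star_sub]
    noncomm_ring
  exact sub_nonneg.1 (h2 ▸ h)

theorem star_mul_mul_self_le {x : H →L[ℂ] H} (hx : ‖x‖ ≤ 1) (y : H →L[ℂ] H) :
    star (x * y) * (x * y) ≤ star y * y := by
  have h1 : star x * x ≤ 1 := by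
    refine CStarAlgebra.star_mul_le_algebraMap_norm_sq.trans ?_
    rw [Algebra.algebraMap_eq_smul_one]
    refine (smul_le_smul_of_nonneg_right (pow_le_one₀ (norm_nonneg x) hx)
      zero_le_one).trans_eq (one_smul _ _)
  have h2 := star_left_conjugate_le_conjugate h1 y
  rw [mul_one] at h2
  refine le_trans (le_of_eq ?_) h2
  rw [star_mul]
  simp only [mul_assoc]

theorem norm_le_one_of_le_one {a : H →L[ℂ] H} (h0 : 0 ≤ a) (h1 : a ≤ 1) : ‖a‖ ≤ 1 :=
  norm_le_of_le_smul_one h0 zero_le_one (by rwa [one_smul])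

/-- A substitute for Cauchy-Schwarz, passing from Hilbert-Schmidt to trace smallness on a finite
projection. Expanding `(c f ± c⁻¹ z*)* (c f ± c⁻¹ z*) ≥ 0` with `c² = C` gives `±(z + z*) ≤ d = C f
+ C⁻¹ z z*`, and `a, b` are the halves of `d ± (z + z*)`. -/
theorem exists_nonneg_decomposition
    (hρ : IsFaithfulNormalSemifiniteTrace (M : Set (H →L[ℂ] H)) ρ) {f : H →L[ℂ] H}
    (hf : f ∈ finProjections (M : Set (H →L[ℂ] H)) ρ) {η : ℝ} (hη : 0 < η) :
    ∃ κ : ℝ, 0 < κ ∧ ∀ z ∈ M, z * f = z → ρ (star z * z) ≤ ENNReal.ofReal κ →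
      ∃ a ∈ M, ∃ b ∈ M, 0 ≤ a ∧ 0 ≤ b ∧ z + star z = a - b ∧
        ρ a ≤ ENNReal.ofReal η ∧ ρ b ≤ ENNReal.ofReal η := by
  obtain ⟨⟨hfM, hfp⟩, hft⟩ := hf
  set F := (ρ f).toReal
  have hF : ρ f = ENNReal.ofReal F := (ENNReal.ofReal_toReal hft.ne).symm
  have hF0 : 0 ≤ F := ENNReal.toReal_nonneg
  -- This makes `C ρ(f) ≤ η / 2`; the bound `C (η / 2)` on `ρ(z* z)` makes the other term at most `η
  -- / 2`.
  set C := η / (2 * (F + 1)) with hC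
  have hC0 : 0 < C := by positivity
  refine ⟨C * (η / 2), by positivity, fun z hz hzf hzt => ?_⟩
  set c := √C
  have hcc : c * c = C := Real.mul_self_sqrt hC0.le
  have hc0 : 0 < c := Real.sqrt_pos.2 hC0
  have hfz : f * star z = star z := by
    have := congrArg star hzf
    rwa [star_mul, hfp.isSelfAdjoint.star_eq] at this
  have hsq : ∀ σ : ℝ, σ * σ = 1 →
      star (c • f + (σ * c⁻¹) • star z) * (c • f + (σ * c⁻¹) • star z) =
        (C • f + C⁻¹ • (z * star z)) + σ • (z + star z) := by
    intro σ hσ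
    have k1 : c * (σ * c⁻¹) = σ := by field_simp
    have k2 : σ * c⁻¹ * c = σ := by field_simp
    have k3 : σ * c⁻¹ * (σ * c⁻¹) = C⁻¹ := by
      rw [← hcc, mul_inv]; linear_combination c⁻¹ * c⁻¹ * hσ
    rw [star_add, star_smul, star_smul, star_star, hfp.isSelfAdjoint.star_eq, star_trivial,
      star_trivial, add_mul, mul_add, mul_add]
    simp only [smul_mul_assoc, mul_smul_comm, smul_smul]
    rw [hfp.isIdempotentElem.eq, hfz, hzf, hcc, k1, k2, k3, smul_add]
    abel
  set d := C • f + C⁻¹ • (z * star z) with hd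
  have hp : 0 ≤ d + (z + star z) := by
    have := star_mul_self_nonneg (c • f + ((1 : ℝ) * c⁻¹) • star z)
    rwa [hsq 1 (by norm_num), one_smul] at this
  have hm : 0 ≤ d - (z + star z) := by
    have := star_mul_self_nonneg (c • f + ((-1 : ℝ) * c⁻¹) • star z)
    rwa [hsq (-1) (by norm_num), neg_one_smul, ← sub_eq_add_neg] at this
  have hzz : z * star z ∈ M := mul_mem hz (star_mem hz)
  have hdM : d ∈ M := add_mem (real_smul_mem _ hfM) (real_smul_mem _ hzz)
  have hzM : z + star z ∈ M := add_mem hz (star_mem hz)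
  have haM := real_smul_mem (1 / 2) (add_mem hdM hzM)
  have hbM := real_smul_mem (1 / 2) (sub_mem hdM hzM)
  have ha0 := smul_nonneg (by norm_num : (0 : ℝ) ≤ 1 / 2) hp
  have hb0 := smul_nonneg (by norm_num : (0 : ℝ) ≤ 1 / 2) hm
  have hsum : (1 / 2 : ℝ) • (d + (z + star z)) + (1 / 2 : ℝ) • (d - (z + star z)) = d := by
    rw [← smul_add, add_add_sub_cancel, ← two_smul ℝ d, smul_smul]
    norm_num
  have hdt : ρ d ≤ ENNReal.ofReal η := by
    rw [hd, hρ.map_add _ (real_smul_mem _ hfM) _ (real_smul_mem _ hzz)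
      (smul_nonneg hC0.le hfp.nonneg) (smul_nonneg (by positivity) (mul_star_self_nonneg z)),
      hρ.map_real_smul hfM hfp.nonneg hC0.le,
      hρ.map_real_smul hzz (mul_star_self_nonneg z) (by positivity), ← hρ.tracial z hz]
    calc ENNReal.ofReal C * ρ f + ENNReal.ofReal C⁻¹ * ρ (star z * z)
        ≤ ENNReal.ofReal C * ENNReal.ofReal F +
            ENNReal.ofReal C⁻¹ * ENNReal.ofReal (C * (η / 2)) := by rw [← hF]; gcongr
      _ = ENNReal.ofReal (C * F + C⁻¹ * (C * (η / 2))) := by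
        rw [ENNReal.ofReal_add (by positivity) (by positivity), ENNReal.ofReal_mul (q := F) hC0.le,
          ENNReal.ofReal_mul (p := C⁻¹) (inv_nonneg.2 hC0.le)]
      _ ≤ ENNReal.ofReal η := by
        refine ENNReal.ofReal_le_ofReal ?_
        rw [inv_mul_cancel_left₀ hC0.ne']
        have : C * (2 * (F + 1)) = η := by rw [hC]; field_simp
        nlinarith
  refine ⟨_, haM, _, hbM, ha0, hb0, ?_, ?_, ?_⟩
  · rw [← smul_sub, add_sub_sub_cancel, ← two_smul ℝ (z + star z), smul_smul]
    norm_num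
  · exact (hρ.mono haM hdM ha0 ((le_add_of_nonneg_right hb0).trans_eq hsum)).trans hdt
  · exact (hρ.mono hbM hdM hb0 ((le_add_of_nonneg_left ha0).trans_eq hsum)).trans hdt

theorem lt_top_of_mem_finRankContractions
    (hρ : IsFaithfulNormalSemifiniteTrace (M : Set (H →L[ℂ] H)) ρ) (hNM : N ≤ M)
    {A : H →L[ℂ] H} (hA : A ∈ finRankContractions (N : Set (H →L[ℂ] H)) ρ) : ρ A < ⊤ := by
  obtain ⟨hAN, hA0, hA1, R, ⟨⟨hRN, hR⟩, hRt⟩, hAR⟩ := hA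
  refine (hρ.mono (hNM hAN) (hNM hRN) hA0 ?_).trans_lt hRt
  have h1 : R * A = A := by
    have := congrArg star hAR
    rwa [star_mul, hR.isSelfAdjoint.star_eq, (IsSelfAdjoint.of_nonneg hA0).star_eq] at this
  have := conj_le_conj hR.isSelfAdjoint hA1
  rwa [h1, hAR, mul_one, hR.isIdempotentElem.eq] at this

/-- Replacing `A` by `p + (1 - p - q) A (1 - p - q)` makes it the identity on `p` and zero on `q`. -/
theorem exists_modification (hρ : IsFaithfulNormalSemifiniteTrace (M : Set (H →L[ℂ] H)) ρ)
    {p q : H →L[ℂ] H} (hp : p ∈ finProjections (M : Set (H →L[ℂ] H)) ρ)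
    (hq : q ∈ finProjections (M : Set (H →L[ℂ] H)) ρ) (hpq : p * q = 0) {η : ℝ} (hη : 0 < η) :
    ∃ κ : ℝ, 0 < κ ∧ ∀ A ∈ M, 0 ≤ A → A ≤ 1 → ρ A < ⊤ → ∀ P₁ Q₁ : H →L[ℂ] H,
      P₁ ∈ projections (M : Set (H →L[ℂ] H)) → Q₁ ∈ projections (M : Set (H →L[ℂ] H)) →
      A * P₁ = P₁ → A * Q₁ = 0 →
      ρ (p * (1 - P₁) * p) ≤ ENNReal.ofReal κ → ρ (q * (1 - Q₁) * q) ≤ ENNReal.ofReal κ →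
      ∃ A' ∈ M, 0 ≤ A' ∧ A' ≤ 1 ∧ ρ A' < ⊤ ∧ A' * p = p ∧ A' * q = 0 ∧
        ∃ a ∈ M, ∃ b ∈ M, 0 ≤ a ∧ 0 ≤ b ∧ A' - A = a - b ∧
          ρ a ≤ ENNReal.ofReal η ∧ ρ b ≤ ENNReal.ofReal η := by
  obtain ⟨⟨hpM, hpp⟩, hpt⟩ := hp
  obtain ⟨⟨hqM, hqp⟩, hqt⟩ := hq
  have hpp' : p * p = p := hpp.isIdempotentElem.eq
  have hqq' : q * q = q := hqp.isIdempotentElem.eq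
  have hps : star p = p := hpp.isSelfAdjoint.star_eq
  have hqs : star q = q := hqp.isSelfAdjoint.star_eq
  have hqp' : q * p = 0 := by
    have := congrArg star hpq
    rwa [star_mul, hps, hqs, star_zero] at this
  set f := p + q with hf
  have hfp : IsStarProjection f := hpp.add hqp hpq
  have hfM : f ∈ M := add_mem hpM hqM
  have hfs : star f = f := hfp.isSelfAdjoint.star_eq
  have hff : f * f = f := hfp.isIdempotentElem.eq
  have hft : ρ f < ⊤ := by
    rw [hf, hρ.map_add _ hpM _ hqM hpp.nonneg hqp.nonneg]
    exact ENNReal.add_lt_top.2 ⟨hpt, hqt⟩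
  have hfp1 : f * p = p := by rw [hf, add_mul, hpp', hqp', add_zero]
  have hpf : p * f = p := by rw [hf, mul_add, hpp', hpq, add_zero]
  have hfq1 : f * q = q := by rw [hf, add_mul, hpq, hqq', zero_add]
  have hqf : q * f = q := by rw [hf, mul_add, hqp', hqq', zero_add]
  obtain ⟨κ, hκ, hdec⟩ := exists_nonneg_decomposition hρ ⟨⟨hfM, hfp⟩, hft⟩ hη
  -- The `4` pays for the factor `2` in `star_mul_self_add_le` and for the two defects, of `p` and
  -- of `q`.
  refine ⟨κ / 4, by positivity, fun A hA hA0 hA1 hAt P₁ Q₁ hP₁ hQ₁ hAP hAQ hpt₁ hqt₁ => ?_⟩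
  have hAs : star A = A := (IsSelfAdjoint.of_nonneg hA0).star_eq
  have h1f : IsStarProjection (1 - f) := hfp.one_sub
  have h1fM : 1 - f ∈ M := sub_mem (one_mem M) hfM
  set k := (1 - f) * A * (1 - f) with hk
  have hkM : k ∈ M := mul_mem (mul_mem h1fM hA) h1fM
  have hk0 : 0 ≤ k := conj_nonneg h1f.isSelfAdjoint hA0
  have hk1 : k ≤ 1 - f := by
    have := conj_le_conj h1f.isSelfAdjoint hA1
    rwa [mul_one, h1f.isIdempotentElem.eq] at this
  set w₁ := (1 - P₁) * p with hw₁
  set w₂ := (1 - Q₁) * q with hw₂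
  -- Because `A P₁ = P₁` and `A Q₁ = 0`, the error `A f - p = -(1 - A) p + A q` sees only the parts
  -- `w₁, w₂` of `p, q` outside `P₁, Q₁`.
  set g := (1 - A) * (-w₁) + A * w₂ with hg
  have hgeq : g = A * f - p := by
    have e1 : (1 - A) * (1 - P₁) = 1 - A := by
      rw [mul_sub, mul_one, sub_mul, one_mul, hAP, sub_self, sub_zero]
    have e2 : A * (1 - Q₁) = A := by rw [mul_sub, mul_one, hAQ, sub_zero]
    rw [hg, hw₁, hw₂, mul_neg, ← mul_assoc, ← mul_assoc, e1, e2, hf]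
    noncomm_ring
  have hw₁M : w₁ ∈ M := mul_mem (sub_mem (one_mem M) hP₁.1) hpM
  have hw₂M : w₂ ∈ M := mul_mem (sub_mem (one_mem M) hQ₁.1) hqM
  have hgM : g ∈ M := by rw [hgeq]; exact sub_mem (mul_mem hA hfM) hpM
  have hgf : g * f = g := by rw [hgeq, sub_mul, mul_assoc, hff, hpf]
  -- The change `p + k - A = p + f A f - A f - f A` is split as `z + z*` with `z = z f`, sharing `p`
  -- and `f A f` equally between the two halves.
  set z := ((1 / 2 : ℝ) • f - 1) * g with hz
  have hzM : z ∈ M := mul_mem (sub_mem (real_smul_mem _ hfM) (one_mem M)) hgM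
  have hzf : z * f = z := by rw [hz, mul_assoc, hgf]
  have hzsum : z + star z = p + k - A := by
    have e1 : z = (1 / 2 : ℝ) • (f * A * f) + (1 / 2 : ℝ) • p - A * f := by
      rw [hz, hgeq, sub_mul, one_mul, smul_mul_assoc, mul_sub, hfp1, smul_sub, ← mul_assoc]
      have : p = (1 / 2 : ℝ) • p + (1 / 2 : ℝ) • p := by rw [← add_smul]; norm_num
      nth_rw 2 [this]
      abel
    have e2 : star z = (1 / 2 : ℝ) • (f * A * f) + (1 / 2 : ℝ) • p - f * A := by
      rw [e1, star_sub, star_add, star_smul, star_smul, star_mul, star_mul, star_mul, hfs, hAs, hps,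
        star_trivial, ← mul_assoc]
    have e3 : ∀ x : H →L[ℂ] H, (1 / 2 : ℝ) • x + (1 / 2 : ℝ) • x = x := fun x => by
      rw [← add_smul]; norm_num
    calc z + star z = ((1 / 2 : ℝ) • (f * A * f) + (1 / 2 : ℝ) • (f * A * f)) +
          ((1 / 2 : ℝ) • p + (1 / 2 : ℝ) • p) - A * f - f * A := by rw [e2, e1]; abel
      _ = p + k - A := by rw [e3, e3, hk]; noncomm_ring
  have hzz : star z * z ≤ (2 : ℝ) • (star w₁ * w₁ + star w₂ * w₂) := by
    have n1 : ‖(1 / 2 : ℝ) • f - 1‖ ≤ 1 := by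
      rw [norm_sub_rev]
      refine norm_le_one_of_le_one (sub_nonneg.2 ?_) (sub_le_self _ (smul_nonneg (by norm_num) hfp.nonneg))
      refine (smul_le_smul_of_nonneg_left hfp.le_one (by norm_num)).trans ?_
      exact (smul_le_smul_of_nonneg_right (by norm_num : (1 / 2 : ℝ) ≤ 1) zero_le_one).trans_eq
        (one_smul _ _)
    refine (star_mul_mul_self_le n1 g).trans ((star_mul_self_add_le _ _).trans ?_)
    refine smul_le_smul_of_nonneg_left (add_le_add ?_ ?_) (by norm_num)
    · refine (star_mul_mul_self_le (norm_le_one_of_le_one (sub_nonneg.2 hA1) (sub_le_self _ hA0)) _).trans_eq ?_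
      rw [star_neg, neg_mul_neg]
    · exact star_mul_mul_self_le (norm_le_one_of_le_one hA0 hA1) _
  have hw : ∀ {s S : H →L[ℂ] H}, star s = s → IsStarProjection S →
      star ((1 - S) * s) * ((1 - S) * s) = s * (1 - S) * s := fun {s S} hs hS => by
    rw [star_mul, hs, hS.one_sub.isSelfAdjoint.star_eq, ← mul_assoc, mul_assoc s,
      hS.one_sub.isIdempotentElem.eq]
  have m1 : star w₁ * w₁ ∈ M := mul_mem (star_mem hw₁M) hw₁M
  have m2 : star w₂ * w₂ ∈ M := mul_mem (star_mem hw₂M) hw₂M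
  have hzt : ρ (star z * z) ≤ ENNReal.ofReal κ := by
    refine (hρ.mono (mul_mem (star_mem hzM) hzM) (real_smul_mem _ (add_mem m1 m2))
      (star_mul_self_nonneg z) hzz).trans ?_
    rw [hρ.map_real_smul (add_mem m1 m2)
      (add_nonneg (star_mul_self_nonneg _) (star_mul_self_nonneg _)) (by norm_num),
      hρ.map_add _ m1 _ m2 (star_mul_self_nonneg _) (star_mul_self_nonneg _), hw hps hP₁.2,
      hw hqs hQ₁.2]
    refine (mul_le_mul_right (add_le_add hpt₁ hqt₁) _).trans_eq ?_
    rw [← ENNReal.ofReal_add (by positivity) (by positivity), ← ENNReal.ofReal_mul (by norm_num)]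
    congr 1
    ring
  obtain ⟨a, ha, b, hb, ha0, hb0, hab, hat, hbt⟩ := hdec z hzM hzf hzt
  refine ⟨p + k, add_mem hpM hkM, add_nonneg hpp.nonneg hk0, ?_, ?_, ?_, ?_, a, ha, b, hb, ha0, hb0,
    hzsum ▸ hab, hat, hbt⟩
  · refine (add_le_add_right hk1 p).trans ?_
    have : p + (1 - f) = 1 - q := by rw [hf]; abel
    rw [this]
    exact sub_le_self _ hqp.nonneg
  · rw [hρ.map_add _ hpM _ hkM hpp.nonneg hk0]
    exact ENNReal.add_lt_top.2 ⟨hpt, (hρ.conj_proj_le hA h1fM hA0 h1f).trans_lt hAt⟩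
  · rw [add_mul, hpp', hk, mul_assoc, sub_mul 1 f p, one_mul, hfp1, sub_self, mul_zero, add_zero]
  · rw [add_mul, hpq, hk, mul_assoc, sub_mul 1 f q, one_mul, hfq1, sub_self, mul_zero, add_zero]

/-- The bimodule property carries the conditions on `P, Q` from `A` to `E A`, and the norm contracts
after commuting `E` with `α j`. Only finiteness of the trace of `E A` is clear, not finite rank,
hence the use of `finModulus_le_iSup`. -/
theorem finModulus_restrictAut_le (hJ : IsSymmetricNorm (M : Set (H →L[ℂ] H)) ρ J)
    (hρ : IsFaithfulNormalSemifiniteTrace (M : Set (H →L[ℂ] H)) ρ) {hNM : N ≤ M}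
    {E : M.toStarSubalgebra →ₗ[ℂ] N.toStarSubalgebra} (hE : IsConditionalExpectation hNM ρ E)
    (hEJ : ∀ x : M.toStarSubalgebra, (x : H →L[ℂ] H) ∈ boundedL1 (M : Set (H →L[ℂ] H)) ρ →
      J (E x : H →L[ℂ] H) ≤ J (x : H →L[ℂ] H))
    {n : ℕ} {α : Fin n → Aut M} (hα : ∀ j, PreservesTrace ρ (α j))
    (hαN : ∀ j, MapsOnto hNM (α j)) {P Q : H →L[ℂ] H}
    (hP : P ∈ projections (N : Set (H →L[ℂ] H))) (hQ : Q ∈ projections (N : Set (H →L[ℂ] H))) :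
    finModulus N ρ J (fun j => restrictAut hNM (α j) (hαN j)) P Q ≤ finModulus M ρ J α P Q := by
  refine le_iInf₂ fun A ⟨hA, hAP, hAQ⟩ => ?_
  have hA0 : 0 ≤ (A : H →L[ℂ] H) := hA.2.1
  have hAt := lt_top_of_mem_finRankContractions hρ le_rfl hA
  have hmul : ∀ y : N.toStarSubalgebra, E (A * incl hNM y) = E A * y := fun y => by
    simpa using hE.bimodule 1 y A
  have hE1 : E 1 = 1 := by simpa using hE.map_incl 1
  have hEA1 : (E A : H →L[ℂ] H) ≤ 1 := by
    have h := hE.nonneg (1 - A) (sub_nonneg.2 hA.2.2.1)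
    rw [map_sub, hE1] at h
    exact sub_nonneg.1 h
  have hEP : (E A : H →L[ℂ] H) * P = P := by
    have h1 := hmul ⟨P, hP.1⟩
    have h2 : A * incl hNM ⟨P, hP.1⟩ = incl hNM ⟨P, hP.1⟩ := Subtype.ext hAP
    rw [h2, hE.map_incl] at h1
    exact (congrArg Subtype.val h1).symm
  have hEQ : (E A : H →L[ℂ] H) * Q = 0 := by
    have h1 := hmul ⟨Q, hQ.1⟩
    have h2 : A * incl hNM ⟨Q, hQ.1⟩ = 0 := Subtype.ext hAQ
    rw [h2, map_zero] at h1
    exact (congrArg Subtype.val h1).symm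
  refine (finModulus_le_iSup hJ hρ hNM _ (fun j x hx => ?_) (E A) (hE.nonneg A hA0) hEA1
    (by rwa [hE.trace_eq A hA0]) hP.2 hEP hEQ).trans (iSup_mono fun j => ?_)
  · exact hα j (incl hNM x) hx
  · refine ENNReal.ofReal_le_ofReal ?_
    have hL : ((α j A - A : M.toStarSubalgebra) : H →L[ℂ] H) ∈
        boundedL1 (M : Set (H →L[ℂ] H)) ρ :=
      hρ.sub_mem_boundedL1 (α j A).2 A.2 ((α j).map_nonneg hA0) hA0 (by rwa [hα j A hA0]) hAt
    have h := hEJ (α j A - A) hL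
    rw [map_sub] at h
    rw [coe_restrictAut, ← hE.map_aut hρ (hα j) (hαN j) hA0 hAt]
    exact h

theorem modulus_restrictAut_le (hJ : IsSymmetricNorm (M : Set (H →L[ℂ] H)) ρ J)
    (hρ : IsFaithfulNormalSemifiniteTrace (M : Set (H →L[ℂ] H)) ρ) {hNM : N ≤ M}
    {E : M.toStarSubalgebra →ₗ[ℂ] N.toStarSubalgebra} (hE : IsConditionalExpectation hNM ρ E)
    (hEJ : ∀ x : M.toStarSubalgebra, (x : H →L[ℂ] H) ∈ boundedL1 (M : Set (H →L[ℂ] H)) ρ →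
      J (E x : H →L[ℂ] H) ≤ J (x : H →L[ℂ] H))
    {n : ℕ} {α : Fin n → Aut M} (hα : ∀ j, PreservesTrace ρ (α j))
    (hαN : ∀ j, MapsOnto hNM (α j)) (P Q : H →L[ℂ] H) :
    modulus N ρ J (fun j => restrictAut hNM (α j) (hαN j)) P Q ≤ modulus M ρ J α P Q := by
  refine iSup₂_le fun P' hP' => iSup₂_le fun Q' hQ' => iSup_le fun h => ?_
  refine (finModulus_restrictAut_le hJ hρ hE hEJ hα hαN hP'.1 hQ'.1).trans ?_
  have hPM : P' ∈ finProjections (M : Set (H →L[ℂ] H)) ρ := ⟨⟨hNM hP'.1.1, hP'.1.2⟩, hP'.2⟩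
  have hQM : Q' ∈ finProjections (M : Set (H →L[ℂ] H)) ρ := ⟨⟨hNM hQ'.1.1, hQ'.1.2⟩, hQ'.2⟩
  exact le_iSup₂_of_le P' hPM (le_iSup₂_of_le Q' hQM (le_iSup_of_le h le_rfl))

theorem modulus_le_restrictAut (hJ : IsSymmetricNorm (M : Set (H →L[ℂ] H)) ρ J)
    (hρ : IsFaithfulNormalSemifiniteTrace (M : Set (H →L[ℂ] H)) ρ) {hNM : N ≤ M}
    (hN : IsSemifinite (N : Set (H →L[ℂ] H)) ρ)
    {n : ℕ} {α : Fin n → Aut M} (hα : ∀ j, PreservesTrace ρ (α j))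
    (hαN : ∀ j, MapsOnto hNM (α j)) {P Q : H →L[ℂ] H}
    (hP : P ∈ projections (N : Set (H →L[ℂ] H))) (hQ : Q ∈ projections (N : Set (H →L[ℂ] H)))
    (hPQ : P * Q = 0) :
    modulus M ρ J α P Q ≤ modulus N ρ J (fun j => restrictAut hNM (α j) (hαN j)) P Q := by
  refine iSup₂_le fun p hp => iSup₂_le fun q hq => iSup_le fun ⟨hpP, hqQ⟩ => ?_
  have hpq : p * q = 0 := by
    rw [← mul_eq_of_le' hP.2 hp.1.2.nonneg hpP, ← mul_eq_of_le hQ.2 hq.1.2.nonneg hqQ, mul_assoc,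
      ← mul_assoc P, hPQ, zero_mul, mul_zero]
  refine ENNReal.le_of_forall_pos_le_add fun ε hε hfin => ?_
  have hε2 : (0 : ℝ) < ε / 2 := half_pos (NNReal.coe_pos.2 hε)
  obtain ⟨η, hη, hpert⟩ := hJ.exists_perturbation hρ one_pos hε2
  obtain ⟨κ, hκ, hmod⟩ := exists_modification hρ hp hq hpq hη
  have hκ' : ENNReal.ofReal κ ≠ 0 := by simpa using hκ
  obtain ⟨P₁, hP₁, hP₁P, hpt⟩ :=
    exists_finProjection_trace_conj_sub_le hρ hNM hN hP.1 hP.2 hp hpP hκ'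
  obtain ⟨Q₁, hQ₁, hQ₁Q, hqt⟩ :=
    exists_finProjection_trace_conj_sub_le hρ hNM hN hQ.1 hQ.2 hq hqQ hκ'
  have hle : finModulus N ρ J (fun j => restrictAut hNM (α j) (hαN j)) P₁ Q₁ ≤
      modulus N ρ J (fun j => restrictAut hNM (α j) (hαN j)) P Q :=
    le_iSup₂_of_le P₁ hP₁ (le_iSup₂_of_le Q₁ hQ₁ (le_iSup_of_le ⟨hP₁P, hQ₁Q⟩ le_rfl))
  -- Half of `ε` is spent on choosing a nearly optimal `A` for `P₁, Q₁`, half on correcting it to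
  -- `A'`.
  have hlt := hle.trans_lt (ENNReal.lt_add_right hfin.ne
    (b := ENNReal.ofReal (ε / 2)) (by simpa using hε2))
  rw [finModulus] at hlt
  simp only [iInf_lt_iff] at hlt
  obtain ⟨A, ⟨hA, hAP, hAQ⟩, hAlt⟩ := hlt
  have hAt := lt_top_of_mem_finRankContractions hρ hNM hA
  obtain ⟨A', hA'M, hA'0, hA'1, hA't, hA'p, hA'q, a, ha, b, hb, ha0, hb0, hab, hat, hbt⟩ :=
    hmod A (hNM A.2) hA.2.1 hA.2.2.1 hAt P₁ Q₁ ⟨hNM hP₁.1.1, hP₁.1.2⟩ ⟨hNM hQ₁.1.1, hQ₁.1.2⟩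
      hAP hAQ hpt hqt
  refine (finModulus_le_iSup hJ hρ le_rfl α hα ⟨A', hA'M⟩ hA'0 hA'1 hA't hp.1.2 hA'p hA'q).trans ?_
  have hstep := iSup_ofReal_le_add (n := n) (ε := (ε : ℝ) / 2)
    (f := fun j => J ((α j ⟨A', hA'M⟩ : H →L[ℂ] H) - A'))
    (g := fun j => J ((restrictAut hNM (α j) (hαN j) A : H →L[ℂ] H) - A)) fun j =>
      -- The perturbation takes place in `M`, as `A'` need not lie in `N`; on `A` the automorphism
      -- and its restriction agree.
      hpert M le_rfl (α j) (hα j) (incl hNM A) ⟨A', hA'M⟩ ⟨a, ha⟩ ⟨b, hb⟩ hA.2.1 hA'0 ha0 hb0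
        hAt hA't (Subtype.ext hab) (by rw [one_smul]; exact (sub_le_self _ hA.2.1).trans hA'1)
        (by rw [one_smul]; exact (sub_le_self _ hA'0).trans hA.2.2.1) hat hbt
  refine hstep.trans ((add_le_add_left hAlt.le _).trans_eq ?_)
  rw [add_assoc, ← ENNReal.ofReal_add hε2.le hε2.le, add_halves, ENNReal.ofReal_coe_nnreal]

end Comparison

end Condenser

theorem proposition3p2 {H : Type*} [NormedAddCommGroup H] [InnerProductSpace ℂ H] [CompleteSpace H]
    [TopologicalSpace.SeparableSpace H]
    (M : VonNeumannAlgebra H) (ρ : (H →L[ℂ] H) → ℝ≥0∞)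
    (hρ : Condenser.IsFaithfulNormalSemifiniteTrace (M : Set (H →L[ℂ] H)) ρ)
    (hM : Condenser.IsAtomic (M : Set (H →L[ℂ] H)) ∨
      (Condenser.IsDiffuse (M : Set (H →L[ℂ] H)) ∧ ρ 1 = ⊤))
    (J : (H →L[ℂ] H) → ℝ)
    (hJ : Condenser.IsSymmetricOperatorNorm (M : Set (H →L[ℂ] H)) ρ J)
    (N : VonNeumannAlgebra H) (hNM : N ≤ M)
    (hN : Condenser.IsSemifinite (N : Set (H →L[ℂ] H)) ρ)
    (E : M.toStarSubalgebra →ₗ[ℂ] N.toStarSubalgebra)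
    (hE : Condenser.IsConditionalExpectation hNM ρ E)
    (hEJ : ∀ x : M.toStarSubalgebra,
      (x : H →L[ℂ] H) ∈ Condenser.boundedL1 (M : Set (H →L[ℂ] H)) ρ →
        J (E x : H →L[ℂ] H) ≤ J (x : H →L[ℂ] H))
    (n : ℕ) (α : Fin n → Condenser.Aut M)
    (hαρ : ∀ j, Condenser.PreservesTrace ρ (α j))
    (hαN : ∀ j, Condenser.MapsOnto hNM (α j))
    (P Q : H →L[ℂ] H)
    (hP : P ∈ Condenser.projections (N : Set (H →L[ℂ] H)))
    (hQ : Q ∈ Condenser.projections (N : Set (H →L[ℂ] H)))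
    (hPQ : P * Q = 0) :
    Condenser.modulus M ρ J α P Q =
      Condenser.modulus N ρ J (fun j => Condenser.restrictAut hNM (α j) (hαN j)) P Q :=
  le_antisymm (Condenser.modulus_le_restrictAut hJ.toIsSymmetricNorm hρ hN hαρ hαN hP hQ hPQ)
    (Condenser.modulus_restrictAut_le hJ.toIsSymmetricNorm hρ hE hEJ hαρ hαN P Q)
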